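/- Let $n\ge 0$, let $E$ be a complex vector space of dimension $2n+1$ with a skew-symmetric bilinear form $\omega$ of maximal rank $2n$, and let $e_0$ generate the one-dimensional kernel of $\omega$. Let $\mathrm{Sp}_{2n+1}$ be the stabilizer of $\omega$ in $\mathrm{GL}(E)$. Let $F$ be a complex vector space of dimension $2n$ with a symplectic form. A subspace is isotropic if the given form vanishes on it. Write $G_\omega(k,2n+1)$ and $G_\omega(k,2n)$ for the varieties of isotropic $k$-dimensional subspaces of $E$ and $F$, write $\mathbb F_\omega(2n+1)$ for the variety of flags $V_1\subset\dots\subset V_{n+1}$ of isotropic subspaces of $E$ with $\dim V_j=j$, and $\mathbb F_\omega(2n)$ for the variety of flags $W_1\subset\dots\subset W_n$ of isotropic subspaces of $F$ with $\dim W_j=j$; they are subvarieties of the usual Grassmannians and flag manifolds. Put $V_0=0$, $W_0=0$. Subsets of these varieties carry the induced structure, and isomorphisms are isomorphisms of algebraic varieties. (1) The group $\mathrm{Sp}_{2n+1}$ acts on $\mathbb F_\omega(2n+1)$ with exactly $n+1$ orbits, namely $$\mathcal O_i=\{V_\bullet\in\mathbb F_\omega(2n+1)\mid e_0\in V_i,\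 e_0\notin V_{i-1}\},\qquad 1\le i\le n+1.$$ For every $1\le i\le n+1$, the orbit $\mathcal O_i$ is isomorphic to the total space of the dual $T_{i-1}^*$ of the tautological bundle $T_{i-1}$ of rank $i-1$ on $\mathbb F_\omega(2n)$, whose fibre at $W_\bullet$ is $W_{i-1}$. (2) For $1\le k\le n$, the group $\mathrm{Sp}_{2n+1}$ acts on $G_\omega(k,2n+1)$ with exactly two orbits, $$X_0=\{V\mid e_0\in V\},\qquad X_1=\{V\mid e_0\notin V\}.$$ The orbit $X_0$ is closed and isomorphic to $G_\omega(k-1,2n)$; the orbit $X_1$ is open and isomorphic to the total space of the dual of the tautological bundle on $G_\omega(k,2n)$, whose fibre at $W$ is $W$. -/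

import Mathlib

open Topology

namespace OddSymplectic

/-! ### Spaces with functions

Complex algebraic varieties (in the classical sense) form a full subcategory of the category of
spaces with functions: a topological space with, on every open subset, an algebra of regular
`ℂ`-valued functions, where regularity is local and a regular function may be inverted on the open
set where it does not vanish. -/

/-- A space with functions. `Reg U f` says that the restriction of `f` to `U` is regular; it is
meaningful for open `U`, and depends only on the values of `f` on `U`. -/
structure FunSpace (X : Type*) where
  top : TopologicalSpace X
  Reg : Set X → (X → ℂ) → Prop
  reg_congr : ∀ {U : Set X} {f g : X → ℂ}, Set.EqOn f g U → Reg U f → Reg U g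
  reg_const : ∀ (U : Set X) (c : ℂ), Reg U (fun _ => c)
  reg_add : ∀ {U : Set X} {f g : X → ℂ}, Reg U f → Reg U g → Reg U (f + g)
  reg_mul : ∀ {U : Set X} {f g : X → ℂ}, Reg U f → Reg U g → Reg U (f * g)
  reg_mono : ∀ {U V : Set X} {f : X → ℂ}, V ⊆ U → Reg U f → Reg V f
  reg_local : ∀ {U : Set X} {f : X → ℂ},
    (∀ x ∈ U, ∃ V, IsOpen[top] V ∧ x ∈ V ∧ V ⊆ U ∧ Reg V f) → Reg U f
  reg_inv : ∀ {U : Set X} {f : X → ℂ}, IsOpen[top] U → Reg U f →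
    IsOpen[top] {x | x ∈ U ∧ f x ≠ 0} ∧ Reg {x | x ∈ U ∧ f x ≠ 0} (fun x => (f x)⁻¹)

/-- A morphism: a continuous map that pulls regular functions back to regular functions. -/
def FunSpace.IsMorphism {X Y : Type*} (S : FunSpace X) (T : FunSpace Y) (φ : X → Y) : Prop :=
  (∀ V, IsOpen[T.top] V → IsOpen[S.top] (φ ⁻¹' V)) ∧
    ∀ V, IsOpen[T.top] V → ∀ f, T.Reg V f → S.Reg (φ ⁻¹' V) (f ∘ φ)

/-- Two spaces with functions (e.g. varieties) are isomorphic if there are mutually inverse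
morphisms between them. -/
def FunSpace.Isomorphic {X Y : Type*} (S : FunSpace X) (T : FunSpace Y) : Prop :=
  ∃ e : X ≃ Y, S.IsMorphism T e ∧ T.IsMorphism S e.symm

/-- The polynomial functions on a complex vector space. -/
def polyFun (M : Type*) [AddCommGroup M] [Module ℂ M] : Subalgebra ℂ (M → ℂ) :=
  Algebra.adjoin ℂ (Set.range fun l : Module.Dual ℂ M => (l : M → ℂ))

/-- The Zariski topology on a (finite-dimensional) complex vector space: the sets `{p ≠ 0}`, for
`p` polynomial, are a basis. -/
abbrev zariski (M : Type*) [AddCommGroup M] [Module ℂ M] : TopologicalSpace M where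
  IsOpen U := ∀ x ∈ U, ∃ p ∈ polyFun M, p x ≠ 0 ∧ ∀ y, p y ≠ 0 → y ∈ U
  isOpen_univ := fun _ _ => ⟨1, one_mem _, by simp, by simp⟩
  isOpen_inter := by
    rintro U V hU hV x ⟨hxU, hxV⟩
    obtain ⟨p, hp, hpx, hpU⟩ := hU x hxU
    obtain ⟨q, hq, hqx, hqV⟩ := hV x hxV
    refine ⟨p * q, mul_mem hp hq, mul_ne_zero hpx hqx, fun y hy => ?_⟩
    exact ⟨hpU y (left_ne_zero_of_mul hy), hqV y (right_ne_zero_of_mul hy)⟩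
  isOpen_sUnion := by
    rintro s hs x ⟨U, hU, hxU⟩
    obtain ⟨p, hp, hpx, hpU⟩ := hs U hU x hxU
    exact ⟨p, hp, hpx, fun y hy => ⟨U, hU, hpU y hy⟩⟩

/-- Affine space: a finite-dimensional complex vector space with its Zariski topology and the
functions that are locally quotients of polynomials. -/
def affineSpace (M : Type*) [AddCommGroup M] [Module ℂ M] : FunSpace M where
  top := zariski M
  Reg U f := ∀ x ∈ U, ∃ p ∈ polyFun M, ∃ q ∈ polyFun M, q x ≠ 0 ∧
    ∀ y ∈ U, q y ≠ 0 → f y = p y / q y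
  reg_congr := by
    intro U f g h hf x hx
    obtain ⟨p, hp, q, hq, hqx, H⟩ := hf x hx
    exact ⟨p, hp, q, hq, hqx, fun y hy hqy => (h hy) ▸ H y hy hqy⟩
  reg_const := fun U c x _ =>
    ⟨algebraMap ℂ _ c, Subalgebra.algebraMap_mem _ c, 1, one_mem _, by simp, by simp⟩
  reg_add := by
    intro U f g hf hg x hx
    obtain ⟨p, hp, q, hq, hqx, H⟩ := hf x hx
    obtain ⟨p', hp', q', hq', hqx', H'⟩ := hg x hx
    refine ⟨p * q' + q * p', add_mem (mul_mem hp hq') (mul_mem hq hp'), q * q',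
      mul_mem hq hq', mul_ne_zero hqx hqx', fun y hy hqy => ?_⟩
    have h1 := left_ne_zero_of_mul hqy
    have h2 := right_ne_zero_of_mul hqy
    simp only [Pi.add_apply, Pi.mul_apply, H y hy h1, H' y hy h2]
    exact div_add_div _ _ h1 h2
  reg_mul := by
    intro U f g hf hg x hx
    obtain ⟨p, hp, q, hq, hqx, H⟩ := hf x hx
    obtain ⟨p', hp', q', hq', hqx', H'⟩ := hg x hx
    refine ⟨p * p', mul_mem hp hp', q * q',
      mul_mem hq hq', mul_ne_zero hqx hqx', fun y hy hqy => ?_⟩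
    have h1 := left_ne_zero_of_mul hqy
    have h2 := right_ne_zero_of_mul hqy
    simp only [Pi.mul_apply, H y hy h1, H' y hy h2]
    exact div_mul_div_comm _ _ _ _
  reg_mono := by
    intro U V f hVU hf x hx
    obtain ⟨p, hp, q, hq, hqx, H⟩ := hf x (hVU hx)
    exact ⟨p, hp, q, hq, hqx, fun y hy => H y (hVU hy)⟩
  reg_local := by
    intro U f hf x hx
    obtain ⟨V, hV, hxV, hVU, h⟩ := hf x hx
    obtain ⟨p, hp, q, hq, hqx, H⟩ := h x hxV
    obtain ⟨r, hr, hrx, hrV⟩ := hV x hxV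
    refine ⟨p * r, mul_mem hp hr, q * r, mul_mem hq hr, mul_ne_zero hqx hrx, fun y _ hy => ?_⟩
    have h1 := left_ne_zero_of_mul hy
    have h2 := right_ne_zero_of_mul hy
    rw [H y (hrV y h2) h1]
    exact (mul_div_mul_right _ _ h2).symm
  reg_inv := by
    intro U f hU hf
    constructor
    · rintro x ⟨hx, hfx⟩
      obtain ⟨p, hp, q, hq, hqx, H⟩ := hf x hx
      obtain ⟨r, hr, hrx, hrU⟩ := hU x hx
      have hpx : p x ≠ 0 := by
        intro h
        rw [H x hx hqx, h, zero_div] at hfx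
        exact hfx rfl
      refine ⟨p * q * r, mul_mem (mul_mem hp hq) hr,
        mul_ne_zero (mul_ne_zero hpx hqx) hrx, fun y hy => ?_⟩
      have h3 := right_ne_zero_of_mul hy
      have h1 := left_ne_zero_of_mul (left_ne_zero_of_mul hy)
      have h2 := right_ne_zero_of_mul (left_ne_zero_of_mul hy)
      refine ⟨hrU y h3, ?_⟩
      rw [H y (hrU y h3) h2]
      exact div_ne_zero h1 h2
    · rintro x ⟨hx, hfx⟩
      obtain ⟨p, hp, q, hq, hqx, H⟩ := hf x hx
      have hpx : p x ≠ 0 := by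
        intro h
        rw [H x hx hqx, h, zero_div] at hfx
        exact hfx rfl
      refine ⟨q * q, mul_mem hq hq, p * q, mul_mem hp hq, mul_ne_zero hpx hqx, ?_⟩
      rintro y ⟨hy, _⟩ hpq
      have h1 := left_ne_zero_of_mul hpq
      have h2 := right_ne_zero_of_mul hpq
      simp only [Pi.mul_apply]
      rw [H y hy h2, inv_div, mul_div_mul_right _ _ h2]

/-- The structure induced on `Y` by a map `g : Y → X` (for an inclusion: the structure of a
subspace). A function is regular if it is locally the pullback of a regular function. -/
def FunSpace.induced {X Y : Type*} (S : FunSpace X) (g : Y → X) : FunSpace Y where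
  top := TopologicalSpace.induced g S.top
  Reg U f := ∀ y ∈ U, ∃ V, IsOpen[S.top] V ∧ g y ∈ V ∧ ∃ h, S.Reg V h ∧
    ∀ z ∈ U, g z ∈ V → f z = h (g z)
  reg_congr := by
    intro U f f' hff' hf y hy
    obtain ⟨V, hV, hyV, h, hh, H⟩ := hf y hy
    exact ⟨V, hV, hyV, h, hh, fun z hz hzV => (hff' hz) ▸ H z hz hzV⟩
  reg_const := fun U c y _ => ⟨Set.univ, @isOpen_univ _ S.top, trivial, fun _ => c,
    S.reg_const _ _, fun _ _ _ => rfl⟩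
  reg_add := by
    intro U f f' hf hf' y hy
    obtain ⟨V, hV, hyV, h, hh, H⟩ := hf y hy
    obtain ⟨V', hV', hyV', h', hh', H'⟩ := hf' y hy
    refine ⟨V ∩ V', @IsOpen.inter _ S.top _ _ hV hV', ⟨hyV, hyV'⟩, h + h',
      S.reg_add (S.reg_mono Set.inter_subset_left hh) (S.reg_mono Set.inter_subset_right hh'),
      fun z hz hzV => ?_⟩
    simp only [Pi.add_apply, H z hz hzV.1, H' z hz hzV.2]
  reg_mul := by
    intro U f f' hf hf' y hy
    obtain ⟨V, hV, hyV, h, hh, H⟩ := hf y hy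
    obtain ⟨V', hV', hyV', h', hh', H'⟩ := hf' y hy
    refine ⟨V ∩ V', @IsOpen.inter _ S.top _ _ hV hV', ⟨hyV, hyV'⟩, h * h',
      S.reg_mul (S.reg_mono Set.inter_subset_left hh) (S.reg_mono Set.inter_subset_right hh'),
      fun z hz hzV => ?_⟩
    simp only [Pi.mul_apply, H z hz hzV.1, H' z hz hzV.2]
  reg_mono := by
    intro U W f hWU hf y hy
    obtain ⟨V, hV, hyV, h, hh, H⟩ := hf y (hWU hy)
    exact ⟨V, hV, hyV, h, hh, fun z hz => H z (hWU hz)⟩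
  reg_local := by
    intro U f hf y hy
    obtain ⟨W, ⟨W', hW', rfl⟩, hyW, hWU, hfW⟩ := hf y hy
    obtain ⟨V, hV, hyV, h, hh, H⟩ := hfW y hyW
    exact ⟨W' ∩ V, @IsOpen.inter _ S.top _ _ hW' hV, ⟨hyW, hyV⟩, h,
      S.reg_mono Set.inter_subset_right hh, fun z _ hzV => H z hzV.1 hzV.2⟩
  reg_inv := by
    rintro U f ⟨U', hU', rfl⟩ hf
    constructor
    · refine (@isOpen_iff_forall_mem_open _ (TopologicalSpace.induced g S.top) _).2 ?_
      rintro y ⟨hy, hfy⟩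
      obtain ⟨V, hV, hyV, h, hh, H⟩ := hf y hy
      refine ⟨g ⁻¹' (U' ∩ {x | x ∈ V ∧ h x ≠ 0}), ?_,
        ⟨_, @IsOpen.inter _ S.top _ _ hU' (S.reg_inv hV hh).1, rfl⟩, hy, hyV, ?_⟩
      · rintro z ⟨hz, hzV, hhz⟩
        exact ⟨hz, by rwa [H z hz hzV]⟩
      · rwa [← H y hy hyV]
    · rintro y ⟨hy, hfy⟩
      obtain ⟨V, hV, hyV, h, hh, H⟩ := hf y hy
      refine ⟨{x | x ∈ V ∧ h x ≠ 0}, (S.reg_inv hV hh).1, ⟨hyV, ?_⟩, _, (S.reg_inv hV hh).2, ?_⟩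
      · rwa [← H y hy hyV]
      · rintro z ⟨hz, _⟩ ⟨hzV, _⟩
        exact congrArg _ (H z hz hzV)

/-- The quotient structure on `X` along a map `π : A → X`: sets are open, and functions regular,
if their pullbacks to `A` are. -/
def FunSpace.coinduced {A X : Type*} (S : FunSpace A) (π : A → X) : FunSpace X where
  top := TopologicalSpace.coinduced π S.top
  Reg U f := S.Reg (π ⁻¹' U) (f ∘ π)
  reg_congr := fun h hf => S.reg_congr (fun _ ha => h ha) hf
  reg_const := fun _ c => S.reg_const _ c
  reg_add := fun hf hg => S.reg_add hf hg
  reg_mul := fun hf hg => S.reg_mul hf hg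
  reg_mono := fun h hf => S.reg_mono (Set.preimage_mono h) hf
  reg_local := by
    intro U f hf
    refine S.reg_local fun a ha => ?_
    obtain ⟨V, hV, haV, hVU, h⟩ := hf (π a) ha
    exact ⟨π ⁻¹' V, hV, haV, Set.preimage_mono hVU, h⟩
  reg_inv := fun hU hf => S.reg_inv hU hf

/-- A subset of `X`, with the structure of a subspace. -/
def FunSpace.sub {X : Type*} (S : FunSpace X) (Z : Set X) : FunSpace Z :=
  S.induced Subtype.val

section LinearAlgebra

variable {E : Type*} [AddCommGroup E] [Module ℂ E]

/-! ### Grassmannians and flag manifolds -/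

variable (E) in
/-- The set of `k`-frames in `E`. -/
abbrev Frame (k : ℕ) : Type _ := {v : Fin k → E // LinearIndependent ℂ v}

variable (E) in
/-- The set of frames, an open subset of the affine space `E ^ k`. -/
def frameSpace (k : ℕ) : FunSpace (Frame E k) :=
  (affineSpace (Fin k → E)).induced Subtype.val

variable (E) in
/-- The product of the set of `k`-frames with the dual space of `E`. -/
def frameDualSpace (k : ℕ) : FunSpace (Frame E k × Module.Dual ℂ E) :=
  (affineSpace ((Fin k → E) × Module.Dual ℂ E)).induced fun a => (a.1.1, a.2)

variable (E) in
/-- The Grassmannian of `k`-dimensional subspaces of `E`. -/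
abbrev Gr (k : ℕ) : Type _ := {V : Submodule ℂ E // Module.finrank ℂ V = k}

/-- The subspace spanned by a frame. -/
def Gr.ofFrame {k : ℕ} (v : Frame E k) : Gr E k :=
  ⟨Submodule.span ℂ (Set.range v.1), by
    simpa using finrank_span_eq_card v.2⟩

variable (E) in
/-- The Grassmannian as a variety: the quotient of the variety of frames by `GL_k`. -/
def Gr.space (k : ℕ) : FunSpace (Gr E k) := (frameSpace E k).coinduced Gr.ofFrame

variable (E) in
/-- Flags `0 = V 0 ⊂ V 1 ⊂ ⋯ ⊂ V m` of subspaces of `E` with `dim V j = j`. -/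
@[ext] structure Flag (m : ℕ) where
  V : Fin (m + 1) → Submodule ℂ E
  mono : Monotone V
  finrank_eq : ∀ j, Module.finrank ℂ (V j) = j

/-- The flag whose `j`-th member is spanned by the first `j` vectors of a frame. -/
def Flag.ofFrame {m : ℕ} (v : Frame E m) : Flag E m where
  V j := Submodule.span ℂ (Set.range fun s : Fin j => v.1 (s.castLE (Nat.le_of_lt_succ j.2)))
  mono := by
    intro i j hij
    refine Submodule.span_mono ?_
    rintro _ ⟨s, rfl⟩
    exact ⟨s.castLE hij, rfl⟩
  finrank_eq j := by
    simpa [Function.comp_def] using finrank_span_eq_card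
      (v.2.comp (fun s : Fin j => s.castLE (Nat.le_of_lt_succ j.2)) (Fin.castLE_injective _))

variable (E) in
/-- The flag manifold (without isotropy conditions) as a variety: the quotient of the variety of
frames by the triangular group. -/
def Flag.space (m : ℕ) : FunSpace (Flag E m) := (frameSpace E m).coinduced Flag.ofFrame

/-! ### Total spaces of the duals of the tautological bundles

The dual of a tautological bundle `T ⊂ E × X` is the quotient of the trivial bundle with fibre
the dual of `E` by the annihilator of `T`, through restriction of linear forms. -/

variable (E) in
/-- The total space of the dual of the tautological bundle on `Gr E k`. -/
abbrev Gr.DualTaut (k : ℕ) : Type _ := Σ W : Gr E k, Module.Dual ℂ W.1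

variable (E) in
/-- The variety structure on the total space of the dual of the tautological bundle. -/
def Gr.dualTautSpace (k : ℕ) : FunSpace (Gr.DualTaut E k) :=
  (frameDualSpace E k).coinduced fun a => ⟨Gr.ofFrame a.1, a.2.domRestrict (Gr.ofFrame a.1).1⟩

variable (E) in
/-- The total space of the dual of the rank `j` tautological bundle on `Flag E m`. -/
abbrev Flag.DualTaut (m : ℕ) (j : Fin (m + 1)) : Type _ := Σ W : Flag E m, Module.Dual ℂ (W.V j)

variable (E) in
/-- The variety structure on the total space of the dual of the rank `j` tautological bundle. -/
def Flag.dualTautSpace (m : ℕ) (j : Fin (m + 1)) : FunSpace (Flag.DualTaut E m j) :=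
  (frameDualSpace E m).coinduced fun a =>
    ⟨Flag.ofFrame a.1, a.2.domRestrict ((Flag.ofFrame a.1).V j)⟩

/-! ### Isotropic Grassmannians and flag manifolds -/

/-- `V` is isotropic with respect to `ω`. -/
def IsIsotropic (ω : LinearMap.BilinForm ℂ E) (V : Submodule ℂ E) : Prop :=
  ∀ x ∈ V, ∀ y ∈ V, ω x y = 0

/-- The Grassmannian of isotropic `k`-dimensional subspaces. -/
abbrev IsoGr (ω : LinearMap.BilinForm ℂ E) (k : ℕ) : Type _ :=
  {V : Gr E k // IsIsotropic ω V.1}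

/-- The isotropic Grassmannian as a subvariety of the Grassmannian. -/
def IsoGr.space (ω : LinearMap.BilinForm ℂ E) (k : ℕ) : FunSpace (IsoGr ω k) :=
  (Gr.space E k).induced Subtype.val

/-- The total space of the dual of the tautological bundle on the isotropic Grassmannian. -/
abbrev IsoGr.DualTaut (ω : LinearMap.BilinForm ℂ E) (k : ℕ) : Type _ :=
  Σ W : IsoGr ω k, Module.Dual ℂ W.1.1

/-- Its variety structure: it is the restriction of the bundle on the whole Grassmannian. -/
def IsoGr.dualTautSpace (ω : LinearMap.BilinForm ℂ E) (k : ℕ) : FunSpace (IsoGr.DualTaut ω k) :=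
  (Gr.dualTautSpace E k).induced fun x => ⟨x.1.1, x.2⟩

/-- The manifold of flags `V 1 ⊂ ⋯ ⊂ V m` of isotropic subspaces with `dim V j = j`. -/
abbrev IsoFlag (ω : LinearMap.BilinForm ℂ E) (m : ℕ) : Type _ :=
  {V : Flag E m // ∀ j, IsIsotropic ω (V.V j)}

/-- The isotropic flag manifold as a subvariety of the flag manifold. -/
def IsoFlag.space (ω : LinearMap.BilinForm ℂ E) (m : ℕ) : FunSpace (IsoFlag ω m) :=
  (Flag.space E m).induced Subtype.val

/-- The total space of the dual of the rank `j` tautological bundle on the isotropic flag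
manifold. -/
abbrev IsoFlag.DualTaut (ω : LinearMap.BilinForm ℂ E) (m : ℕ) (j : Fin (m + 1)) : Type _ :=
  Σ W : IsoFlag ω m, Module.Dual ℂ (W.1.V j)

/-- Its variety structure: it is the restriction of the bundle on the whole flag manifold. -/
def IsoFlag.dualTautSpace (ω : LinearMap.BilinForm ℂ E) (m : ℕ) (j : Fin (m + 1)) :
    FunSpace (IsoFlag.DualTaut ω m j) :=
  (Flag.dualTautSpace E m j).induced fun x => ⟨x.1.1, x.2⟩

/-! ### The group and its actions -/

/-- The group of linear automorphisms that preserve `ω`: the (odd) symplectic group. -/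
def Sp (ω : LinearMap.BilinForm ℂ E) : Subgroup (E ≃ₗ[ℂ] E) where
  carrier := {g | ∀ x y, ω (g x) (g y) = ω x y}
  mul_mem' := by
    intro g h hg hh x y
    rw [LinearEquiv.mul_apply, LinearEquiv.mul_apply, hg, hh]
  one_mem' := fun _ _ => rfl
  inv_mem' := by
    intro g hg x y
    rw [← hg (g⁻¹ x) (g⁻¹ y)]
    simp

/-- The image of a subspace under an automorphism. -/
def move (g : E ≃ₗ[ℂ] E) (V : Submodule ℂ E) : Submodule ℂ E := V.map (g : E →ₗ[ℂ] E)

theorem move_one (V : Submodule ℂ E) : move 1 V = V := Submodule.map_id V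

theorem move_mul (g h : E ≃ₗ[ℂ] E) (V : Submodule ℂ E) : move (g * h) V = move g (move h V) :=
  Submodule.map_comp (h : E →ₗ[ℂ] E) (g : E →ₗ[ℂ] E) V

theorem finrank_move (g : E ≃ₗ[ℂ] E) (V : Submodule ℂ E) :
    Module.finrank ℂ (move g V) = Module.finrank ℂ V := LinearEquiv.finrank_map_eq g V

theorem isIsotropic_move {ω : LinearMap.BilinForm ℂ E} (g : Sp ω) {V : Submodule ℂ E}
    (hV : IsIsotropic ω V) : IsIsotropic ω (move g.1 V) := by
  rintro _ ⟨x, hx, rfl⟩ _ ⟨y, hy, rfl⟩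
  exact (g.2 x y).trans (hV x hx y hy)

instance (ω : LinearMap.BilinForm ℂ E) (k : ℕ) : MulAction (Sp ω) (IsoGr ω k) where
  smul g V := ⟨⟨move g.1 V.1.1, (finrank_move _ _).trans V.1.2⟩, isIsotropic_move g V.2⟩
  one_smul _ := Subtype.ext (Subtype.ext (move_one _))
  mul_smul _ _ _ := Subtype.ext (Subtype.ext (move_mul _ _ _))

instance (ω : LinearMap.BilinForm ℂ E) (m : ℕ) : MulAction (Sp ω) (IsoFlag ω m) where
  smul g V := ⟨⟨fun j => move g.1 (V.1.V j), fun _ _ hij => Submodule.map_mono (V.1.mono hij),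
    fun j => (finrank_move _ _).trans (V.1.finrank_eq j)⟩, fun j => isIsotropic_move g (V.2 j)⟩
  one_smul _ := Subtype.ext (Flag.ext (funext fun _ => move_one _))
  mul_smul _ _ _ := Subtype.ext (Flag.ext (funext fun _ => move_mul _ _ _))

/-- The set of orbits of a group action. -/
def orbits (G X : Type*) [Group G] [MulAction G X] : Set (Set X) :=
  Set.range fun x : X => MulAction.orbit G x

/-! ### The subsets given by incidence with the kernel -/

/-- Isotropic flags with `e₀ ∈ V i` and `e₀ ∉ V (i - 1)`. Here `i : Fin (n + 1)` stands for the
index `i + 1` in `{1, …, n + 1}`. -/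
def flagStratum (ω : LinearMap.BilinForm ℂ E) (e₀ : E) (n : ℕ) (i : Fin (n + 1)) :
    Set (IsoFlag ω (n + 1)) :=
  {V | e₀ ∈ V.1.V i.succ ∧ e₀ ∉ V.1.V i.castSucc}

/-- Isotropic `k`-dimensional subspaces that contain `e₀`. -/
def grContaining (ω : LinearMap.BilinForm ℂ E) (e₀ : E) (k : ℕ) : Set (IsoGr ω k) :=
  {V | e₀ ∈ V.1.1}

/-- Isotropic `k`-dimensional subspaces that do not contain `e₀`. -/
def grAvoiding (ω : LinearMap.BilinForm ℂ E) (e₀ : E) (k : ℕ) : Set (IsoGr ω k) :=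
  {V | e₀ ∉ V.1.1}

end LinearAlgebra

end OddSymplectic

open OddSymplectic

/-! Choose a complement of the line of `e₀`. Since `e₀` spans the radical, `ω` is nondegenerate on
the complement, which is therefore isometric to `F`. This gives a projection `p : E → F` with kernel
the line of `e₀`, a section `sec` of `p`, and a coordinate `lam` along `e₀` (`exists_splitting`). As
`ω` is pulled back along `p`, isotropy of a subspace of `E` only depends on its image in `F`.

A subspace that avoids `e₀` is the graph of a unique linear form on its image `W`, that is, a point
of the dual tautological bundle over `W`; a subspace that contains `e₀` is the preimage of its
image. A flag in which `e₀` enters at step `i` consists of graphs before that step and of preimages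
from then on, so it amounts to a flag in `F` with a linear form on one member (`flagGraph`). These
bijections are morphisms because on frames they are given by polynomials. Their inverses are
morphisms because near a given subspace Cramer's rule produces a normalized frame that depends
regularly on the subspace; `isomorphic_of_local` glues these local inverses.

Orbits: the group preserves the line of `e₀`, hence every stratum. Transitivity is Witt's theorem in
`F` (`IsotropicFamily.exists_isometry`), lifted to `E` by adding a multiple of `e₀` that corrects
the `lam`-coordinates (`exists_mem_Sp`). The flag strata cover everything because an isotropic
subspace of dimension `n + 1` must contain `e₀`: otherwise its image in `F` would be isotropic of
dimension `n + 1`. -/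

namespace OddSymplectic

/-! ### Morphisms defined on open subsets -/

namespace FunSpace

variable {X Y Z : Type*} {S : FunSpace X} {T : FunSpace Y} {R : FunSpace Z}

/-- The restriction of `φ` to the open subset `U` is a morphism. -/
structure IsMorphismOn (S : FunSpace X) (T : FunSpace Y) (U : Set X) (φ : X → Y) : Prop where
  isOpen : ∀ V, IsOpen[T.top] V → IsOpen[S.top] (U ∩ φ ⁻¹' V)
  reg : ∀ V, IsOpen[T.top] V → ∀ f, T.Reg V f → S.Reg (U ∩ φ ⁻¹' V) (f ∘ φ)

theorem isMorphismOn_univ {φ : X → Y} : S.IsMorphismOn T Set.univ φ ↔ S.IsMorphism T φ := by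
  constructor
  · rintro ⟨h1, h2⟩
    simp only [Set.univ_inter] at h1 h2
    exact ⟨h1, h2⟩
  · rintro ⟨h1, h2⟩
    exact ⟨by simpa only [Set.univ_inter] using h1, by simpa only [Set.univ_inter] using h2⟩

theorem isMorphism_of_local {φ : X → Y} (h : ∀ x, ∃ U, x ∈ U ∧ S.IsMorphismOn T U φ) :
    S.IsMorphism T φ := by
  constructor
  · intro V hV
    refine (@isOpen_iff_forall_mem_open _ S.top _).2 fun x hx => ?_
    obtain ⟨U, hxU, hU⟩ := h x
    exact ⟨U ∩ φ ⁻¹' V, Set.inter_subset_right, hU.isOpen V hV, hxU, hx⟩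
  · intro V hV f hf
    refine S.reg_local fun x hx => ?_
    obtain ⟨U, hxU, hU⟩ := h x
    exact ⟨U ∩ φ ⁻¹' V, hU.isOpen V hV, ⟨hxU, hx⟩, Set.inter_subset_right, hU.reg V hV f hf⟩

theorem IsMorphismOn.comp {U : Set X} {W : Set Y} {φ : X → Y} {ψ : Y → Z}
    (hψ : T.IsMorphismOn R W ψ) (hφ : S.IsMorphismOn T U φ) (h : Set.MapsTo φ U W) :
    S.IsMorphismOn R U (ψ ∘ φ) := by
  have key : ∀ V, U ∩ ψ ∘ φ ⁻¹' V = U ∩ φ ⁻¹' (W ∩ ψ ⁻¹' V) := by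
    intro V
    ext x
    simp only [Set.mem_inter_iff, Set.mem_preimage, Function.comp_apply]
    exact ⟨fun ⟨h1, h2⟩ => ⟨h1, h h1, h2⟩, fun ⟨h1, _, h2⟩ => ⟨h1, h2⟩⟩
  constructor
  · intro V hV
    rw [key]
    exact hφ.isOpen _ (hψ.isOpen V hV)
  · intro V hV f hf
    rw [key]
    exact hφ.reg _ (hψ.isOpen V hV) _ (hψ.reg V hV f hf)

theorem IsMorphism.comp {φ : X → Y} {ψ : Y → Z} (hψ : T.IsMorphism R ψ) (hφ : S.IsMorphism T φ) :
    S.IsMorphism R (ψ ∘ φ) :=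
  isMorphismOn_univ.1 ((isMorphismOn_univ.2 hψ).comp (isMorphismOn_univ.2 hφ) fun _ _ => trivial)

theorem IsMorphism.comp_isMorphismOn {U : Set X} {φ : X → Y} {ψ : Y → Z}
    (hψ : T.IsMorphism R ψ) (hφ : S.IsMorphismOn T U φ) : S.IsMorphismOn R U (ψ ∘ φ) :=
  (isMorphismOn_univ.2 hψ).comp hφ fun _ _ => trivial

theorem IsMorphismOn.congr {U : Set X} {φ ψ : X → Y} (hφ : S.IsMorphismOn T U φ)
    (h : Set.EqOn φ ψ U) : S.IsMorphismOn T U ψ := by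
  have key : ∀ V, U ∩ ψ ⁻¹' V = U ∩ φ ⁻¹' V := by
    intro V
    ext x
    simp only [Set.mem_inter_iff, Set.mem_preimage]
    exact and_congr_right fun hx => by rw [h hx]
  constructor
  · intro V hV
    rw [key]
    exact hφ.isOpen V hV
  · intro V hV f hf
    rw [key]
    exact S.reg_congr (fun x hx => congrArg f (h hx.1)) (hφ.reg V hV f hf)

/-- A morphism, restricted to the preimage of an open subset on which another morphism lives. -/
theorem IsMorphismOn.comp_isMorphism {W : Set Y} {φ : X → Y} {ψ : Y → Z}
    (hψ : T.IsMorphismOn R W ψ) (hφ : S.IsMorphism T φ) :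
    S.IsMorphismOn R (φ ⁻¹' W) (ψ ∘ φ) :=
  ⟨fun V hV => hφ.1 _ (hψ.isOpen V hV), fun V hV f hf => hφ.2 _ (hψ.isOpen V hV) _ (hψ.reg V hV f hf)⟩

theorem isMorphism_coinduced_mk (S : FunSpace X) (π : X → Y) : S.IsMorphism (S.coinduced π) π :=
  ⟨fun _ h => h, fun _ _ _ h => h⟩

/-- Universal property of the quotient: maps out of Grassmannians, flag manifolds and bundles are
checked on frames. -/
theorem isMorphism_coinduced {π : X → Y} {φ : Y → Z} (h : S.IsMorphism R (φ ∘ π)) :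
    (S.coinduced π).IsMorphism R φ := ⟨h.1, h.2⟩

theorem isMorphism_induced_map (S : FunSpace X) (g : Y → X) : (S.induced g).IsMorphism S g :=
  ⟨fun V hV => ⟨V, hV, rfl⟩, fun V hV f hf _ hy => ⟨V, hV, hy, f, hf, fun _ _ _ => rfl⟩⟩

/-- A regular function of the induced structure is a pullback only locally, so regularity is
verified near each point and glued with `reg_local`. -/
theorem isMorphismOn_induced {g : Y → Z} {U : Set X} {φ : X → Y}
    (h : S.IsMorphismOn R U (g ∘ φ)) : S.IsMorphismOn (R.induced g) U φ := by
  have ho : ∀ V, IsOpen[(R.induced g).top] V → IsOpen[S.top] (U ∩ φ ⁻¹' V) := by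
    rintro _ ⟨W, hW, rfl⟩
    exact h.isOpen W hW
  refine ⟨ho, fun V hV f hf => S.reg_local fun x hx => ?_⟩
  obtain ⟨W, hW, hxW, k, hk, H⟩ := hf (φ x) hx.2
  refine ⟨(U ∩ φ ⁻¹' V) ∩ (U ∩ (g ∘ φ) ⁻¹' W), @IsOpen.inter _ S.top _ _ (ho V hV) (h.isOpen W hW),
    ⟨hx, hx.1, hxW⟩, Set.inter_subset_left, ?_⟩
  exact S.reg_congr (fun y hy => (H (φ y) hy.1.2 hy.2.2).symm)
    (S.reg_mono Set.inter_subset_right (h.reg W hW k hk))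

theorem isMorphism_induced {g : Y → Z} {φ : X → Y} (h : S.IsMorphism R (g ∘ φ)) :
    S.IsMorphism (R.induced g) φ :=
  isMorphismOn_univ.1 (isMorphismOn_induced (isMorphismOn_univ.2 h))

/-! ### Regular functions and regular maps to vector spaces -/

theorem reg_sum {ι : Type*} (s : Finset ι) {U : Set X} {f : ι → X → ℂ}
    (h : ∀ i ∈ s, S.Reg U (f i)) : S.Reg U (fun x => ∑ i ∈ s, f i x) := by
  classical
  induction s using Finset.induction_on with
  | empty => simpa using S.reg_const U 0
  | insert a s ha ih =>
    simp only [Finset.sum_insert ha]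
    exact S.reg_add (h a (by simp)) (ih fun i hi => h i (by simp [hi]))

theorem reg_prod {ι : Type*} (s : Finset ι) {U : Set X} {f : ι → X → ℂ}
    (h : ∀ i ∈ s, S.Reg U (f i)) : S.Reg U (fun x => ∏ i ∈ s, f i x) := by
  classical
  induction s using Finset.induction_on with
  | empty => simpa using S.reg_const U 1
  | insert a s ha ih =>
    simp only [Finset.prod_insert ha]
    exact S.reg_mul (h a (by simp)) (ih fun i hi => h i (by simp [hi]))

theorem reg_det {k : ℕ} {U : Set X} {M : X → Matrix (Fin k) (Fin k) ℂ}
    (h : ∀ s t, S.Reg U (fun x => M x s t)) : S.Reg U (fun x => (M x).det) := by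
  simp only [Matrix.det_apply']
  exact reg_sum _ fun σ _ => S.reg_mul (S.reg_const U _) (reg_prod _ fun t _ => h _ _)

theorem reg_inv_of_ne_zero {U : Set X} (hU : IsOpen[S.top] U) {f : X → ℂ} (hf : S.Reg U f)
    (h0 : ∀ x ∈ U, f x ≠ 0) : S.Reg U (fun x => (f x)⁻¹) := by
  have h := (S.reg_inv hU hf).2
  have hs : {x | x ∈ U ∧ f x ≠ 0} = U := Set.ext fun x => ⟨And.left, fun hx => ⟨hx, h0 x hx⟩⟩
  rwa [hs] at h

/-- Cramer's rule: an entry of the inverse is a determinant with one row replaced, divided by the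
full determinant. -/
theorem reg_matrix_inv {k : ℕ} {U : Set X} (hU : IsOpen[S.top] U)
    {M : X → Matrix (Fin k) (Fin k) ℂ} (h : ∀ s t, S.Reg U (fun x => M x s t))
    (h0 : ∀ x ∈ U, (M x).det ≠ 0) (s t : Fin k) : S.Reg U (fun x => (M x)⁻¹ s t) := by
  simp only [Matrix.inv_def, Matrix.smul_apply, smul_eq_mul, Ring.inverse_eq_inv',
    Matrix.adjugate_apply]
  refine S.reg_mul (reg_inv_of_ne_zero hU (reg_det h) h0) (reg_det fun a b => ?_)
  simp only [Matrix.updateRow_apply]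
  split_ifs
  · exact S.reg_const U _
  · exact h a b

section Vector

variable {M N : Type*} [AddCommGroup M] [Module ℂ M] [AddCommGroup N] [Module ℂ N]

/-- A map to a vector space all of whose coordinates are regular on `U`. -/
def RegVec (S : FunSpace X) (U : Set X) (φ : X → M) : Prop :=
  ∀ l : Module.Dual ℂ M, S.Reg U (fun x => l (φ x))

theorem RegVec.add {U : Set X} {φ ψ : X → M} (h : S.RegVec U φ) (h' : S.RegVec U ψ) :
    S.RegVec U (fun x => φ x + ψ x) := fun l => by
  simp only [map_add]
  exact S.reg_add (h l) (h' l)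

theorem RegVec.smul {U : Set X} {f : X → ℂ} {φ : X → M} (hf : S.Reg U f) (h : S.RegVec U φ) :
    S.RegVec U (fun x => f x • φ x) := fun l => by
  simp only [map_smul]
  exact S.reg_mul hf (h l)

theorem RegVec.sum {ι : Type*} (s : Finset ι) {U : Set X} {φ : ι → X → M}
    (h : ∀ i ∈ s, S.RegVec U (φ i)) : S.RegVec U (fun x => ∑ i ∈ s, φ i x) := fun l => by
  simpa only [map_sum] using reg_sum s fun i hi => h i hi l

theorem regVec_const (U : Set X) (c : M) : S.RegVec U (fun _ => c) := fun _ => S.reg_const _ _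

theorem RegVec.map {U : Set X} {φ : X → M} (h : S.RegVec U φ) (L : M →ₗ[ℂ] N) :
    S.RegVec U (fun x => L (φ x)) := fun l => h (l ∘ₗ L)

theorem RegVec.congr {U : Set X} {φ ψ : X → M} (h : S.RegVec U φ) (hφ : Set.EqOn φ ψ U) :
    S.RegVec U ψ := fun l => S.reg_congr (fun _ hx => congrArg l (hφ hx)) (h l)

theorem RegVec.prodMk {U : Set X} {φ : X → M} {ψ : X → N} (h : S.RegVec U φ)
    (h' : S.RegVec U ψ) : S.RegVec U (fun x => (φ x, ψ x)) := by
  have := (h.map (LinearMap.inl ℂ M N)).add (h'.map (LinearMap.inr ℂ M N))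
  simpa using this

theorem RegVec.pi {k : ℕ} {U : Set X} {φ : X → Fin k → M}
    (h : ∀ s, S.RegVec U (fun x => φ x s)) : S.RegVec U φ := by
  have := RegVec.sum Finset.univ fun s _ => (h s).map (LinearMap.single ℂ (fun _ => M) s)
  refine this.congr fun x _ => ?_
  simpa using Finset.univ_sum_single (φ x)

theorem RegVec.dual [FiniteDimensional ℂ M] {U : Set X} {φ : X → Module.Dual ℂ M}
    (h : ∀ v, S.Reg U (fun x => φ x v)) : S.RegVec U φ := fun l => by
  obtain ⟨v, rfl⟩ := (Module.evalEquiv ℂ M).surjective l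
  simpa using h v

theorem RegVec.apply [FiniteDimensional ℂ M] {U : Set X} {φ : X → Module.Dual ℂ M} {v : X → M}
    (h : S.RegVec U φ) (h' : S.RegVec U v) : S.Reg U (fun x => φ x (v x)) := by
  let b := Module.finBasis ℂ M
  have h1 : ∀ x, φ x (v x) = ∑ i, b.coord i (v x) * φ x (b i) := by
    intro x
    conv_lhs => rw [← b.sum_repr (v x)]
    simp only [map_sum, map_smul, smul_eq_mul, Module.Basis.coord_apply]
  simp only [h1]
  exact reg_sum _ fun i _ => S.reg_mul (h' (b.coord i)) (h (Module.Dual.eval ℂ M (b i)))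

/-- Linear forms generate the polynomials, so all polynomials pull back to regular functions;
inverting denominators then handles basic open sets and local quotients. -/
theorem RegVec.isMorphismOn {U : Set X} (hU : IsOpen[S.top] U) {φ : X → M}
    (h : S.RegVec U φ) : S.IsMorphismOn (affineSpace M) U φ := by
  have hp : ∀ p ∈ polyFun M, S.Reg U (fun x => p (φ x)) := by
    intro p hp
    refine Algebra.adjoin_induction (p := fun p _ => S.Reg U (fun x => p (φ x))) ?_ ?_ ?_ ?_ hp
    · rintro _ ⟨l, rfl⟩
      exact h l
    · exact fun r => S.reg_const U r
    · exact fun _ _ _ _ h1 h2 => S.reg_add h1 h2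
    · exact fun _ _ _ _ h1 h2 => S.reg_mul h1 h2
  have ho : ∀ V, IsOpen[(affineSpace M).top] V → IsOpen[S.top] (U ∩ φ ⁻¹' V) := by
    intro V hV
    refine (@isOpen_iff_forall_mem_open _ S.top _).2 fun x hx => ?_
    obtain ⟨p, hpp, hpx, hpV⟩ := hV (φ x) hx.2
    exact ⟨_, fun y hy => ⟨hy.1, hpV _ hy.2⟩, (S.reg_inv hU (hp p hpp)).1, hx.1, hpx⟩
  refine ⟨ho, fun V hV f hf => S.reg_local fun x hx => ?_⟩
  obtain ⟨p, hpp, q, hq, hqx, H⟩ := hf (φ x) hx.2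
  have hq' := S.reg_inv (ho V hV) (S.reg_mono Set.inter_subset_left (hp q hq))
  refine ⟨_, hq'.1, ⟨hx, hqx⟩, fun y hy => hy.1, ?_⟩
  refine S.reg_congr (fun y hy => ?_)
    (S.reg_mul (S.reg_mono (fun y hy => hy.1.1) (hp p hpp)) hq'.2)
  exact ((H (φ y) hy.1.2 hy.2).trans (div_eq_mul_inv _ _)).symm

theorem regVec_induced_affineSpace (g : X → M) (U : Set X) :
    ((affineSpace M).induced g).RegVec U g := fun l y _ =>
  ⟨Set.univ, @isOpen_univ _ (affineSpace M).top, trivial, l, fun _ _ =>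
    ⟨l, Algebra.subset_adjoin ⟨l, rfl⟩, 1, one_mem _, by simp, by simp⟩, fun _ _ _ => rfl⟩

end Vector

end FunSpace

section Frames

variable {E : Type*} [AddCommGroup E] [Module ℂ E] {X : Type*} {S : FunSpace X} {k : ℕ}

open FunSpace

theorem regVec_frame (U : Set (Frame E k)) (s : Fin k) :
    (frameSpace E k).RegVec U (fun v => v.1 s) :=
  (regVec_induced_affineSpace (M := Fin k → E) Subtype.val U).map
    (LinearMap.proj (φ := fun _ => E) s)

theorem regVec_frameDual_frame (U : Set (Frame E k × Module.Dual ℂ E)) (s : Fin k) :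
    (frameDualSpace E k).RegVec U (fun a => a.1.1 s) :=
  (regVec_induced_affineSpace (fun a : Frame E k × Module.Dual ℂ E => (a.1.1, a.2)) U).map
    (LinearMap.proj (φ := fun _ => E) s ∘ₗ LinearMap.fst ℂ (Fin k → E) (Module.Dual ℂ E))

theorem regVec_frameDual_dual (U : Set (Frame E k × Module.Dual ℂ E)) :
    (frameDualSpace E k).RegVec U (fun a => a.2) :=
  (regVec_induced_affineSpace (fun a : Frame E k × Module.Dual ℂ E => (a.1.1, a.2)) U).map
    (LinearMap.snd ℂ (Fin k → E) (Module.Dual ℂ E))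

theorem isMorphismOn_frameSpace {U : Set X} (hU : IsOpen[S.top] U) {φ : X → Frame E k}
    (h : ∀ s, S.RegVec U (fun x => (φ x).1 s)) : S.IsMorphismOn (frameSpace E k) U φ :=
  isMorphismOn_induced ((RegVec.pi h).isMorphismOn hU)

theorem isMorphismOn_frameDualSpace {U : Set X} (hU : IsOpen[S.top] U)
    {φ : X → Frame E k × Module.Dual ℂ E} (h : ∀ s, S.RegVec U (fun x => (φ x).1.1 s))
    (h' : S.RegVec U (fun x => (φ x).2)) : S.IsMorphismOn (frameDualSpace E k) U φ :=
  isMorphismOn_induced (((RegVec.pi h).prodMk h').isMorphismOn hU)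

/-- Morphisms on open sets are modelled by total maps, so a frame is needed even where `w x` is
dependent; the frame at the base point `x₀` serves as the irrelevant value. -/
theorem exists_isMorphismOn_frameSpace {U : Set X} (hU : IsOpen[S.top] U) {x₀ : X} (hx₀ : x₀ ∈ U)
    {w : X → Fin k → E} (hw : ∀ s, S.RegVec U (fun x => w x s))
    (hli : ∀ x ∈ U, LinearIndependent ℂ (w x)) :
    ∃ τ : X → Frame E k, S.IsMorphismOn (frameSpace E k) U τ ∧ ∀ x ∈ U, (τ x).1 = w x := by
  classical
  let τ : X → Frame E k := fun x =>
    if h : LinearIndependent ℂ (w x) then ⟨w x, h⟩ else ⟨w x₀, hli x₀ hx₀⟩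
  have hτ : ∀ x ∈ U, (τ x).1 = w x := fun x hx => by simp only [τ, dif_pos (hli x hx)]
  exact ⟨τ, isMorphismOn_frameSpace hU fun s =>
    (hw s).congr fun x hx => (congrFun (hτ x hx) s).symm, hτ⟩

theorem exists_isMorphismOn_frameDualSpace {U : Set X} (hU : IsOpen[S.top] U) {x₀ : X}
    (hx₀ : x₀ ∈ U) {w : X → Fin k → E} (hw : ∀ s, S.RegVec U (fun x => w x s))
    {φ : X → Module.Dual ℂ E} (hφ : S.RegVec U φ) (hli : ∀ x ∈ U, LinearIndependent ℂ (w x)) :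
    ∃ τ : X → Frame E k × Module.Dual ℂ E, S.IsMorphismOn (frameDualSpace E k) U τ ∧
      ∀ x ∈ U, (τ x).1.1 = w x ∧ (τ x).2 = φ x := by
  classical
  let τ : X → Frame E k × Module.Dual ℂ E := fun x =>
    (if h : LinearIndependent ℂ (w x) then ⟨w x, h⟩ else ⟨w x₀, hli x₀ hx₀⟩, φ x)
  have hτ : ∀ x ∈ U, (τ x).1.1 = w x := fun x hx => by simp only [τ, dif_pos (hli x hx)]
  exact ⟨τ, isMorphismOn_frameDualSpace hU
    (fun s => (hw s).congr fun x hx => (congrFun (hτ x hx) s).symm) hφ, fun x hx => ⟨hτ x hx, rfl⟩⟩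

end Frames

/-! ### Independence and dual functionals -/

section LinearIndependence

variable {E : Type*} [AddCommGroup E] [Module ℂ E] {k : ℕ}

theorem of_mulVec_eq (a : Fin k → Module.Dual ℂ E) (v : Fin k → E) (c : Fin k → ℂ) (t : Fin k) :
    ((Matrix.of fun t s => a t (v s)).mulVec c) t = a t (∑ s, c s • v s) := by
  simp [Matrix.mulVec, dotProduct, mul_comm]

theorem linearIndependent_of_det_ne_zero {a : Fin k → Module.Dual ℂ E} {v : Fin k → E}
    (h : (Matrix.of fun t s => a t (v s)).det ≠ 0) : LinearIndependent ℂ v := by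
  rw [Fintype.linearIndependent_iff]
  intro g hg
  have h1 := Matrix.mulVec_injective_iff_isUnit.2
    ((Matrix.isUnit_iff_isUnit_det _).2 (isUnit_iff_ne_zero.2 h))
  have h2 : g = 0 := h1 (by
    ext t
    rw [of_mulVec_eq, hg]
    simp)
  exact fun i => congrFun h2 i

/-- The evaluation matrix is unitriangular. Half of the entries suffice, which is all that
normalized frames of flags provide. -/
theorem linearIndependent_of_lowerTriangular {a : Fin k → Module.Dual ℂ E} {v : Fin k → E}
    (h0 : ∀ t s, t < s → a t (v s) = 0) (h1 : ∀ s, a s (v s) = 1) : LinearIndependent ℂ v := by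
  refine linearIndependent_of_det_ne_zero (a := a) ?_
  have h : (Matrix.of fun t s => a t (v s)).IsLowerTriangular := fun t s hts => h0 t s hts
  rw [Matrix.det_of_isLowerTriangular _ h]
  simp [h1]

theorem exists_dual_functionals {v : Fin k → E} (hv : LinearIndependent ℂ v) :
    ∃ a : Fin k → Module.Dual ℂ E, ∀ t s, a t (v s) = if t = s then 1 else 0 := by
  obtain ⟨g, hg⟩ := (Fintype.linearCombination ℂ v).exists_leftInverse_of_injective
    (LinearMap.ker_eq_bot.2 hv.fintypeLinearCombination_injective)
  refine ⟨fun t => LinearMap.proj t ∘ₗ g, fun t s => ?_⟩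
  have := congrFun (LinearMap.congr_fun hg (Pi.single s 1)) t
  simpa [Fintype.linearCombination_apply_single, Pi.single_apply] using this

theorem exists_dual_apply_eq {v : Fin k → E} (hv : LinearIndependent ℂ v) (c : Fin k → ℂ) :
    ∃ l : Module.Dual ℂ E, ∀ s, l (v s) = c s := by
  obtain ⟨a, ha⟩ := exists_dual_functionals hv
  exact ⟨∑ t, c t • a t, fun s => by simp [ha]⟩

theorem linearIndependent_of_notMem_span : ∀ {k : ℕ} {v : Fin k → E},
    (∀ s, v s ∉ Submodule.span ℂ (v '' {t | t < s})) → LinearIndependent ℂ v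
  | 0, _, _ => linearIndependent_empty_type
  | k + 1, v, h => by
    refine linearIndependent_finSucc'.2 ⟨linearIndependent_of_notMem_span fun s hs => ?_, ?_⟩
    · refine h s.castSucc (Submodule.span_mono ?_ hs)
      rintro _ ⟨t, ht, rfl⟩
      exact ⟨t.castSucc, by simpa using ht, rfl⟩
    · intro hl
      refine h (Fin.last k) (Submodule.span_mono ?_ hl)
      rintro _ ⟨t, rfl⟩
      exact ⟨t.castSucc, Fin.castSucc_lt_last t, rfl⟩

end LinearIndependence

/-! ### Frames of subspaces and of flags -/

section Frames

variable {E : Type*} [AddCommGroup E] [Module ℂ E] {k m : ℕ}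

theorem Gr.mem_ofFrame (v : Frame E k) (s : Fin k) : v.1 s ∈ (Gr.ofFrame v).1 :=
  Submodule.subset_span ⟨s, rfl⟩

theorem Flag.mem_ofFrame (v : Frame E m) {s : Fin m} {j : Fin (m + 1)} (h : (s : ℕ) < j) :
    v.1 s ∈ (Flag.ofFrame v).V j :=
  Submodule.subset_span ⟨⟨s, h⟩, rfl⟩

variable [FiniteDimensional ℂ E]

theorem Gr.eq_of_le {V W : Gr E k} (h : V.1 ≤ W.1) : V = W :=
  Subtype.ext (Submodule.eq_of_le_of_finrank_le h (by rw [V.2, W.2]))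

/-- Equal dimensions turn an inclusion into an equality, so only membership of the frame vectors has
to be checked. -/
theorem Gr.ofFrame_eq {v : Frame E k} {V : Gr E k} (h : ∀ s, v.1 s ∈ V.1) : Gr.ofFrame v = V :=
  Gr.eq_of_le (Submodule.span_le.2 (by rintro _ ⟨s, rfl⟩; exact h s))

theorem Gr.exists_frame (V : Gr E k) : ∃ v : Frame E k, Gr.ofFrame v = V := by
  let b := Module.finBasisOfFinrankEq ℂ V.1 V.2
  have hb : LinearIndependent ℂ (V.1.subtype ∘ b) :=
    b.linearIndependent.map' _ (Submodule.ker_subtype _)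
  exact ⟨⟨V.1.subtype ∘ b, hb⟩, Gr.ofFrame_eq fun s => (b s).2⟩

theorem Flag.eq_of_le {V W : Flag E m} (h : ∀ j, V.V j ≤ W.V j) : V = W :=
  Flag.ext (funext fun j =>
    Submodule.eq_of_le_of_finrank_le (h j) (by rw [V.finrank_eq, W.finrank_eq]))

theorem Flag.ofFrame_eq {v : Frame E m} {V : Flag E m} (h : ∀ s : Fin m, v.1 s ∈ V.V s.succ) :
    Flag.ofFrame v = V := by
  refine Flag.eq_of_le fun j => Submodule.span_le.2 ?_
  rintro _ ⟨s, rfl⟩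
  refine V.mono ?_ (h _)
  rw [Fin.le_def]
  exact s.2

theorem Flag.exists_mem_notMem (V : Flag E m) (s : Fin m) :
    ∃ x ∈ V.V s.succ, x ∉ V.V s.castSucc := by
  by_contra! h
  have := Submodule.finrank_mono (show V.V s.succ ≤ V.V s.castSucc from h)
  rw [V.finrank_eq, V.finrank_eq] at this
  simp at this

/-- The earlier vectors all lie in `V.V s.castSucc`, which excludes `v s`; hence independence. -/
theorem Flag.exists_frame_of_mem (V : Flag E m) (v : Fin m → E)
    (h : ∀ s, v s ∈ V.V s.succ) (h' : ∀ s, v s ∉ V.V s.castSucc) :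
    ∃ w : Frame E m, w.1 = v ∧ Flag.ofFrame w = V := by
  refine ⟨⟨v, linearIndependent_of_notMem_span fun s hs => h' s ?_⟩, rfl, Flag.ofFrame_eq h⟩
  refine Submodule.span_le.2 ?_ hs
  rintro _ ⟨t, ht, rfl⟩
  exact V.mono (show t.succ ≤ s.castSucc from ht) (h t)

theorem Flag.exists_frame (V : Flag E m) : ∃ v : Frame E m, Flag.ofFrame v = V := by
  choose v hv hv' using V.exists_mem_notMem
  obtain ⟨w, -, hw⟩ := V.exists_frame_of_mem v hv hv'
  exact ⟨w, hw⟩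

/-- The hypotheses on `x` have the shape of the stratum condition: on the `i`-th stratum, `e₀` can
be taken as the `i`-th frame vector. -/
theorem Flag.exists_frame_apply_eq (V : Flag E m) (i : Fin m) (x : E) (hx : x ∈ V.V i.succ)
    (hx' : x ∉ V.V i.castSucc) : ∃ v : Frame E m, v.1 i = x ∧ Flag.ofFrame v = V := by
  choose v hv hv' using V.exists_mem_notMem
  obtain ⟨w, hw, hwV⟩ := V.exists_frame_of_mem (Function.update v i x)
    (fun s => by rcases eq_or_ne s i with rfl | hs <;> simp [*])
    (fun s => by rcases eq_or_ne s i with rfl | hs <;> simp [*])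
  exact ⟨w, by rw [hw]; simp, hwV⟩

end Frames

/-! ### Local coordinates on Grassmannians -/

section Chart

open FunSpace

variable {E : Type*} [AddCommGroup E] [Module ℂ E] {k : ℕ}

/-- The linear forms `a` restrict to coordinates on the subspace `W`. -/
def IsChart (a : Fin k → Module.Dual ℂ E) (W : Submodule ℂ E) : Prop :=
  Function.Bijective ((LinearMap.pi a).domRestrict W)

open Classical in
/-- The vector of `W` with given coordinates. -/
noncomputable def chartInv (a : Fin k → Module.Dual ℂ E) (W : Submodule ℂ E) :
    (Fin k → ℂ) →ₗ[ℂ] E :=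
  if h : IsChart a W then
    W.subtype ∘ₗ ((LinearEquiv.ofBijective _ h).symm : (Fin k → ℂ) →ₗ[ℂ] W) else 0

variable {a : Fin k → Module.Dual ℂ E} {W : Submodule ℂ E}

theorem chartInv_mem (a : Fin k → Module.Dual ℂ E) (W : Submodule ℂ E) (c : Fin k → ℂ) :
    chartInv a W c ∈ W := by
  unfold chartInv
  split_ifs
  · simp
  · simp

theorem IsChart.apply_chartInv (h : IsChart a W) (c : Fin k → ℂ) (t : Fin k) :
    a t (chartInv a W c) = c t := by
  rw [chartInv, dif_pos h]
  exact congrFun (LinearEquiv.apply_symm_apply (LinearEquiv.ofBijective _ h) c) t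

theorem IsChart.eq_of_apply_eq (h : IsChart a W) {x y : E} (hx : x ∈ W) (hy : y ∈ W)
    (hxy : ∀ t, a t x = a t y) : x = y :=
  congrArg Subtype.val (@h.1 ⟨x, hx⟩ ⟨y, hy⟩ (funext hxy))

theorem IsChart.chartInv_eq (h : IsChart a W) {x : E} (hx : x ∈ W) {c : Fin k → ℂ}
    (hc : ∀ t, a t x = c t) : chartInv a W c = x :=
  h.eq_of_apply_eq (chartInv_mem a W c) hx fun t => (h.apply_chartInv c t).trans (hc t).symm

/-- Turns the intrinsic chart condition into nonvanishing of a determinant, which is visibly open on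
frames. -/
theorem isChart_span_iff {v : Fin k → E} (hv : LinearIndependent ℂ v) :
    IsChart a (Submodule.span ℂ (Set.range v)) ↔ (Matrix.of fun t s => a t (v s)).det ≠ 0 := by
  rw [← isUnit_iff_ne_zero, ← Matrix.isUnit_iff_isUnit_det]
  have hmem : ∀ c : Fin k → ℂ, ∑ s, c s • v s ∈ Submodule.span ℂ (Set.range v) := fun c =>
    Submodule.sum_mem _ fun s _ => Submodule.smul_mem _ _ (Submodule.subset_span ⟨s, rfl⟩)
  constructor
  · intro h
    rw [← Matrix.mulVec_injective_iff_isUnit]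
    intro c d hcd
    refine hv.fintypeLinearCombination_injective ?_
    simp only [Fintype.linearCombination_apply]
    refine h.eq_of_apply_eq (hmem c) (hmem d) fun t => ?_
    rw [← of_mulVec_eq, ← of_mulVec_eq]
    exact congrFun hcd t
  · intro h
    constructor
    · rintro ⟨x, hx⟩ ⟨y, hy⟩ hxy
      obtain ⟨c, rfl⟩ := (Submodule.mem_span_range_iff_exists_fun ℂ).1 hx
      obtain ⟨d, rfl⟩ := (Submodule.mem_span_range_iff_exists_fun ℂ).1 hy
      have hcd : c = d := Matrix.mulVec_injective_iff_isUnit.2 h (funext fun t => by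
        rw [of_mulVec_eq, of_mulVec_eq]
        exact congrFun hxy t)
      subst hcd
      rfl
    · intro c
      obtain ⟨d, hd⟩ := Matrix.mulVec_surjective_iff_isUnit.2 h c
      refine ⟨⟨_, hmem d⟩, funext fun t => ?_⟩
      rw [← hd, of_mulVec_eq]
      rfl

theorem isChart_of_dual {v : Fin k → E} (h : ∀ t s, a t (v s) = if t = s then 1 else 0) :
    IsChart a (Submodule.span ℂ (Set.range v)) := by
  have h1 : (Matrix.of fun t s => a t (v s)) = 1 := by
    ext t s
    simp [h, Matrix.one_apply]
  have h2 : (Matrix.of fun t s => a t (v s)).det ≠ 0 := by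
    rw [h1, Matrix.det_one]
    exact one_ne_zero
  exact (isChart_span_iff (linearIndependent_of_det_ne_zero h2)).2 h2

variable {X : Type*} {S : FunSpace X} {U : Set X} {v : X → Fin k → E}

theorem isOpen_isChart (hU : IsOpen[S.top] U) (hv : ∀ s, S.RegVec U (fun x => v x s))
    (hi : ∀ x, LinearIndependent ℂ (v x)) (a : Fin k → Module.Dual ℂ E) :
    IsOpen[S.top] {x | x ∈ U ∧ IsChart a (Submodule.span ℂ (Set.range (v x)))} := by
  simp only [isChart_span_iff (hi _)]
  exact (S.reg_inv hU (reg_det fun t s => hv s (a t))).1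

/-- With `A` the matrix of the `a t (v x s)`, the vector with coordinates `c` is the combination of
the `v x s` with coefficients `A⁻¹ c`, regular by Cramer's rule. -/
theorem regVec_chartInv (hU : IsOpen[S.top] U) (hv : ∀ s, S.RegVec U (fun x => v x s))
    (hi : ∀ x, LinearIndependent ℂ (v x)) (a : Fin k → Module.Dual ℂ E)
    (ha : ∀ x ∈ U, IsChart a (Submodule.span ℂ (Set.range (v x)))) (c : Fin k → ℂ) :
    S.RegVec U (fun x => chartInv a (Submodule.span ℂ (Set.range (v x))) c) := by
  have hdet : ∀ x ∈ U, (Matrix.of fun t s => a t (v x s)).det ≠ 0 := fun x hx =>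
    (isChart_span_iff (hi x)).1 (ha x hx)
  have h := RegVec.sum Finset.univ fun s _ => RegVec.smul (reg_sum Finset.univ fun t _ =>
    S.reg_mul (reg_matrix_inv hU (M := fun x => Matrix.of fun t s => a t (v x s))
      (fun t s => hv s (a t)) hdet s t) (S.reg_const U (c t))) (hv s)
  refine h.congr fun x hx => ((ha x hx).chartInv_eq ?_ fun t => ?_).symm
  · exact Submodule.sum_mem _ fun s _ => Submodule.smul_mem _ _ (Submodule.subset_span ⟨s, rfl⟩)
  · refine (of_mulVec_eq a (v x) (Matrix.mulVec _ c) t).symm.trans ?_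
    rw [Matrix.mulVec_mulVec, Matrix.mul_nonsing_inv _ (isUnit_iff_ne_zero.2 (hdet x hx)),
      Matrix.one_mulVec]

end Chart

/-! ### Isotropic frames in symplectic spaces -/

section Symplectic

variable {F : Type*} [AddCommGroup F] [Module ℂ F] [FiniteDimensional ℂ F] {n k : ℕ}
  {ω : LinearMap.BilinForm ℂ F}

/-- A family of vectors that are pairwise orthogonal for `ω`. -/
def IsotropicFamily {E : Type*} [AddCommGroup E] [Module ℂ E] (ω : LinearMap.BilinForm ℂ E)
    {k : ℕ} (u : Fin k → E) : Prop :=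
  ∀ s t, ω (u s) (u t) = 0

theorem IsotropicFamily.isIsotropic_span {E : Type*} [AddCommGroup E] [Module ℂ E]
    {ω : LinearMap.BilinForm ℂ E} {u : Fin k → E} (hu : IsotropicFamily ω u) :
    IsIsotropic ω (Submodule.span ℂ (Set.range u)) := by
  intro x hx y hy
  obtain ⟨c, rfl⟩ := (Submodule.mem_span_range_iff_exists_fun ℂ).1 hx
  obtain ⟨d, rfl⟩ := (Submodule.mem_span_range_iff_exists_fun ℂ).1 hy
  simp [LinearMap.sum_apply, hu _ _]

theorem IsotropicFamily.le_orthogonal {E : Type*} [AddCommGroup E] [Module ℂ E]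
    {ω : LinearMap.BilinForm ℂ E} {u : Fin k → E} (hu : IsotropicFamily ω u) :
    Submodule.span ℂ (Set.range u) ≤ ω.orthogonal (Submodule.span ℂ (Set.range u)) :=
  fun y hy x hx => hu.isIsotropic_span x hx y hy

/-- The span has dimension `k` and lies in its own orthogonal, of dimension `2 * n - k`. -/
theorem IsotropicFamily.card_le (hnd : ω.Nondegenerate) (hF : Module.finrank ℂ F = 2 * n)
    {u : Fin k → F} (hi : LinearIndependent ℂ u) (hu : IsotropicFamily ω u) : k ≤ n := by
  have h := Submodule.finrank_mono hu.le_orthogonal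
  rw [LinearMap.BilinForm.finrank_orthogonal hnd, finrank_span_eq_card hi, hF,
    Fintype.card_fin] at h
  omega

/-- While `m < n`, the orthogonal of the span has dimension `2 * n - m > m`, so it contains a vector
outside the span; `ω` being alternating, adjoining it preserves isotropy. -/
theorem IsotropicFamily.exists_extend (hω : ω.IsAlt) (hnd : ω.Nondegenerate)
    (hF : Module.finrank ℂ F = 2 * n) {u : Fin k → F} (hi : LinearIndependent ℂ u)
    (hu : IsotropicFamily ω u) {m : ℕ} (hkm : k ≤ m) (hmn : m ≤ n) :
    ∃ U : Fin m → F, LinearIndependent ℂ U ∧ IsotropicFamily ω U ∧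
      ∀ s : Fin k, U (s.castLE hkm) = u s := by
  induction m, hkm using Nat.le_induction with
  | base => exact ⟨u, hi, hu, fun s => rfl⟩
  | succ m hkm ih =>
    obtain ⟨U, hUi, hU, hUu⟩ := ih (by omega)
    obtain ⟨x, hx, hx'⟩ : ∃ x ∈ ω.orthogonal (Submodule.span ℂ (Set.range U)),
        x ∉ Submodule.span ℂ (Set.range U) := by
      by_contra! h
      have := Submodule.finrank_mono (show _ ≤ _ from h)
      rw [LinearMap.BilinForm.finrank_orthogonal hnd, finrank_span_eq_card hUi, hF,
        Fintype.card_fin] at this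
      omega
    have hxU : ∀ s, ω (U s) x = 0 := fun s => hx _ (Submodule.subset_span ⟨s, rfl⟩)
    have hUx : ∀ s, ω x (U s) = 0 := fun s => hω.isRefl _ _ (hxU s)
    refine ⟨Fin.snoc U x, linearIndependent_finSnoc.2 ⟨hUi, hx'⟩, ?_, fun s => ?_⟩
    · intro s t
      refine Fin.lastCases ?_ (fun s => ?_) s <;> refine Fin.lastCases ?_ (fun t => ?_) t
      · simpa using hω x
      · simpa using hUx t
      · simpa using hxU s
      · simpa using hU s t
    · rw [← hUu s, ← Fin.snoc_castSucc (α := fun _ => F) x U]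
      rfl

theorem IsotropicFamily.exists_symplectic_basis (hω : ω.IsAlt) (hnd : ω.Nondegenerate)
    (hF : Module.finrank ℂ F = 2 * n) {u : Fin n → F} (hi : LinearIndependent ℂ u)
    (hu : IsotropicFamily ω u) :
    ∃ b : Module.Basis (Fin n ⊕ Fin n) ℂ F, (∀ s, b (Sum.inl s) = u s) ∧
      (∀ s t, ω (b (Sum.inl s)) (b (Sum.inr t)) = if s = t then 1 else 0) ∧
      ∀ s t, ω (b (Sum.inr s)) (b (Sum.inr t)) = 0 := by
  obtain ⟨a, ha⟩ := exists_dual_functionals hi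
  have hneg : ∀ x y, ω x y = - ω y x := fun x y => (hω.neg_eq y x).symm
  -- `toDual` represents a form in the left slot of `ω`; the sign moves it to the right slot, giving
  -- `ω (u s) (z t) = δ`.
  let z : Fin n → F := fun t => -(ω.toDual hnd).symm (a t)
  have hz : ∀ s t, ω (u s) (z t) = if s = t then 1 else 0 := by
    intro s t
    rw [hneg]
    simp only [z, map_neg, LinearMap.neg_apply, LinearMap.BilinForm.apply_toDual_symm_apply, ha,
      neg_neg, eq_comm]
  have hz' : ∀ s t, ω (z t) (u s) = if s = t then -1 else 0 := by
    intro s t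
    rw [hneg, hz]
    split_ifs <;> simp
  -- The `z t` need not be mutually orthogonal. Correcting `z s` and `z t` each removes half of `ω
  -- (z s) (z t)`, and the pairings with `u` do not change.
  let y : Fin n → F := fun t => z t - ∑ s, (2⁻¹ * ω (z t) (z s)) • u s
  have huy : ∀ s t, ω (u s) (y t) = if s = t then 1 else 0 := by
    intro s t
    simp [y, hz, hu s _]
  have hyu : ∀ s t, ω (y t) (u s) = if s = t then -1 else 0 := by
    intro s t
    rw [hneg, huy]
    split_ifs <;> simp
  have hyy : ∀ s t, ω (y s) (y t) = 0 := by
    intro s t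
    have h1 : ω (y s) (y t) = ω (y s) (z t) - ∑ r, (2⁻¹ * ω (z t) (z r)) * ω (y s) (u r) := by
      conv_lhs => rw [show y t = z t - ∑ r, (2⁻¹ * ω (z t) (z r)) • u r from rfl]
      simp
    have h2 : ω (y s) (z t) = ω (z s) (z t) - 2⁻¹ * ω (z s) (z t) := by
      simp [y, hz, LinearMap.sum_apply]
    rw [h1, h2]
    simp only [hyu, mul_ite, mul_neg, mul_one, mul_zero, Finset.sum_ite_eq', Finset.mem_univ,
      if_true]
    rw [hneg (z t) (z s)]
    ring
  have hli : LinearIndependent ℂ (Sum.elim u y) := by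
    rw [Fintype.linearIndependent_iff]
    intro g hg
    rw [Fintype.sum_sum_type] at hg
    simp only [Sum.elim_inl, Sum.elim_inr] at hg
    have e1 : ∀ s, g (Sum.inr s) = 0 := fun s => by
      have := congrArg (ω (u s)) hg
      simpa [huy, hu s _] using this
    have e2 : ∀ s, g (Sum.inl s) = 0 := fun s => by
      have := congrArg (ω (y s)) hg
      simpa [hyu, hyy] using this
    rintro (s | s)
    · exact e2 s
    · exact e1 s
  let b := basisOfLinearIndependentOfCardEqFinrank' _ hli (by
    rw [Fintype.card_sum, Fintype.card_fin, hF]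
    ring)
  have hb : ⇑b = Sum.elim u y := coe_basisOfLinearIndependentOfCardEqFinrank' _ hli _
  exact ⟨b, by simp [hb], by simp [hb, huy], by simp [hb, hyy]⟩

/-- Witt's theorem for isotropic families in two symplectic spaces of the same dimension. -/
theorem IsotropicFamily.exists_isometry {F' : Type*} [AddCommGroup F'] [Module ℂ F']
    [FiniteDimensional ℂ F'] {ω' : LinearMap.BilinForm ℂ F'}
    (hω : ω.IsAlt) (hnd : ω.Nondegenerate) (hF : Module.finrank ℂ F = 2 * n)
    (hω' : ω'.IsAlt) (hnd' : ω'.Nondegenerate) (hF' : Module.finrank ℂ F' = 2 * n)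
    {u : Fin k → F} (hi : LinearIndependent ℂ u) (hu : IsotropicFamily ω u)
    {u' : Fin k → F'} (hi' : LinearIndependent ℂ u') (hu' : IsotropicFamily ω' u') :
    ∃ e : F ≃ₗ[ℂ] F', (∀ x y, ω' (e x) (e y) = ω x y) ∧ ∀ s, e (u s) = u' s := by
  have hk := hu.card_le hnd hF hi
  obtain ⟨U, hUi, hU, hUu⟩ := hu.exists_extend hω hnd hF hi hk le_rfl
  obtain ⟨U', hUi', hU', hUu'⟩ := hu'.exists_extend hω' hnd' hF' hi' hk le_rfl
  obtain ⟨b, hb, hb1, hb2⟩ := hU.exists_symplectic_basis hω hnd hF hUi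
  obtain ⟨b', hb', hb1', hb2'⟩ := hU'.exists_symplectic_basis hω' hnd' hF' hUi'
  -- Both symplectic bases have the same Gram matrix, so matching them is an isometry; they start
  -- with `u` and `u'`.
  let e := b.equiv b' (Equiv.refl _)
  have he : ∀ i, e (b i) = b' i := fun i => by simp [e]
  refine ⟨e, ?_, fun s => by rw [← hUu, ← hb, he, hb', hUu']⟩
  have h : ω'.compl₁₂ (e : F →ₗ[ℂ] F') (e : F →ₗ[ℂ] F') = ω := by
    refine LinearMap.BilinForm.ext_basis b fun i j => ?_
    simp only [LinearMap.compl₁₂_apply, LinearEquiv.coe_coe, he]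
    rcases i with s | s <;> rcases j with t | t
    · rw [hb, hb, hb', hb', hU, hU']
    · rw [hb1, hb1']
    · rw [← hω.neg_eq, ← hω'.neg_eq, hb1, hb1']
    · rw [hb2, hb2']
  intro x y
  exact LinearMap.congr_fun₂ h x y

end Symplectic

/-! ### Splitting of the odd symplectic space -/

/-- A decomposition of `E` as the direct sum of `F` and the line spanned by `e₀`. -/
structure Splitting {E : Type*} [AddCommGroup E] [Module ℂ E] (e₀ : E)
    (F : Type*) [AddCommGroup F] [Module ℂ F] where
  p : E →ₗ[ℂ] F
  sec : F →ₗ[ℂ] E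
  lam : Module.Dual ℂ E
  p_sec : ∀ w, p (sec w) = w
  lam_sec : ∀ w, lam (sec w) = 0
  p_self : p e₀ = 0
  lam_self : lam e₀ = 1
  decomp : ∀ x, sec (p x) + lam x • e₀ = x

theorem exists_splitting {n : ℕ} {E : Type*} [AddCommGroup E] [Module ℂ E]
    (hE : Module.finrank ℂ E = 2 * n + 1) (ω : LinearMap.BilinForm ℂ E) (hω : ω.IsAlt)
    (hrank : Module.finrank ℂ (LinearMap.range ω) = 2 * n)
    (e₀ : E) (he₀ : LinearMap.ker ω = Submodule.span ℂ {e₀})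
    {F : Type*} [AddCommGroup F] [Module ℂ F] [FiniteDimensional ℂ F]
    (hF : Module.finrank ℂ F = 2 * n)
    (ωF : LinearMap.BilinForm ℂ F) (hωF : ωF.IsAlt) (hnd : ωF.Nondegenerate) :
    ∃ P : Splitting e₀ F, ∀ x y, ωF (P.p x) (P.p y) = ω x y := by
  have : FiniteDimensional ℂ E := Module.finite_of_finrank_pos (by omega)
  have hker : Module.finrank ℂ (Submodule.span ℂ {e₀}) = 1 := by
    have := ω.finrank_range_add_finrank_ker
    rw [hrank, he₀] at this
    omega
  have hne : e₀ ≠ 0 := by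
    intro h
    rw [h, Submodule.span_zero_singleton, finrank_bot] at hker
    exact zero_ne_one hker
  have hker1 : ∀ x, ω e₀ x = 0 := fun x => by
    have h : e₀ ∈ LinearMap.ker ω := he₀ ▸ Submodule.mem_span_singleton_self e₀
    rw [LinearMap.mem_ker] at h
    simp [h]
  have hker2 : ∀ x, ω x e₀ = 0 := fun x => hω.isRefl _ _ (hker1 x)
  obtain ⟨lam, hlam⟩ := exists_dual_apply_eq (v := fun _ : Fin 1 => e₀)
    (LinearIndependent.of_subsingleton 0 hne) (fun _ => 1)
  replace hlam := hlam 0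
  let H := LinearMap.ker lam
  have hmem : ∀ x, x - lam x • e₀ ∈ H := fun x => by simp [H, hlam]
  let q : E →ₗ[ℂ] H := LinearMap.codRestrict H (LinearMap.id - lam.smulRight e₀)
    fun x => by simpa using hmem x
  have hq : ∀ x, (q x : E) = x - lam x • e₀ := fun x => rfl
  let ωH : LinearMap.BilinForm ℂ H := ω.restrict H
  have hωH : ∀ x y : H, ωH x y = ω x y := fun x y => rfl
  have hqω : ∀ x y, ωH (q x) (q y) = ω x y := fun x y => by
    rw [hωH, hq, hq]
    simp [hker1, hker2]
  have hHalt : ωH.IsAlt := fun x => hω x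
  -- A vector of `H` orthogonal to `H` is also orthogonal to `e₀`, hence lies in the radical of `ω`;
  -- being a multiple of `e₀` killed by `lam`, it is zero.
  have hHnd : ωH.Nondegenerate := by
    rw [LinearMap.BilinForm.Nondegenerate, LinearMap.IsRefl.nondegenerate_iff_separatingLeft
      hHalt.isRefl]
    intro x hx
    have h1 : (x : E) ∈ LinearMap.ker ω := by
      rw [LinearMap.mem_ker]
      ext y
      have := hx (q y)
      rw [hωH, hq] at this
      simpa [hker2] using this
    rw [he₀] at h1
    obtain ⟨c, hc⟩ := Submodule.mem_span_singleton.1 h1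
    have h2 : lam x = 0 := x.2
    rw [← hc, map_smul, hlam] at h2
    have h3 : c = 0 := by simpa using h2
    rw [h3, zero_smul] at hc
    exact Subtype.ext hc.symm
  have hHdim : Module.finrank ℂ H = 2 * n := by
    have h1 := lam.finrank_range_add_finrank_ker
    have h2 : LinearMap.range lam = ⊤ := LinearMap.range_eq_top.2 fun c => ⟨c • e₀, by simp [hlam]⟩
    rw [h2, finrank_top, hE, Module.finrank_self] at h1
    have h3 : Module.finrank ℂ H = Module.finrank ℂ (LinearMap.ker lam) := rfl
    omega
  -- Witt's theorem for empty families: symplectic spaces of equal dimension are isometric.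
  obtain ⟨e, he, -⟩ := IsotropicFamily.exists_isometry hHalt hHnd hHdim hωF hnd hF
    (u := (Fin.elim0 : Fin 0 → H)) linearIndependent_empty_type (fun s => s.elim0)
    (u' := (Fin.elim0 : Fin 0 → F)) linearIndependent_empty_type (fun s => s.elim0)
  refine ⟨⟨e.toLinearMap ∘ₗ q, H.subtype ∘ₗ e.symm.toLinearMap, lam, fun w => ?_, fun w => ?_, ?_,
    hlam, fun x => ?_⟩, fun x y => ?_⟩
  · have h1 : q (e.symm w : E) = e.symm w := Subtype.ext (by
      have : lam (e.symm w : E) = 0 := (e.symm w).2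
      rw [hq, this, zero_smul, sub_zero])
    simp [h1]
  · exact (e.symm w).2
  · have : q e₀ = 0 := Subtype.ext (by rw [hq, hlam]; simp)
    simp [this]
  · simp [hq]
  · exact (he _ _).trans (hqω x y)

/-! ### A criterion for isomorphisms of subspaces -/

/-- A morphism `Ψ` that identifies the subspace `Y'` of `Y` with the subspace `Z` of `X`, and has
inverses defined on open subsets of `X` that cover `Z`, induces an isomorphism. -/
theorem FunSpace.isomorphic_of_local {X X' Y Y' Z : Type*} {S : FunSpace X} {T : FunSpace Y}
    {g₁ : X' → X} {g₂ : Z → X'} {g' : Y' → Y} {Ψ : Y → X}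
    (hg : Function.Injective (g₁ ∘ g₂)) (hg' : Function.Injective g')
    (hΨ : T.IsMorphism S Ψ) (hinj : Function.Injective Ψ)
    (hrange : ∀ y, (∃ z, g₁ (g₂ z) = Ψ y) ↔ ∃ y', g' y' = y)
    (hloc : ∀ z, ∃ U, g₁ (g₂ z) ∈ U ∧ ∃ ρ : X → Y, S.IsMorphismOn T U ρ ∧
      ∀ z', g₁ (g₂ z') ∈ U → Ψ (ρ (g₁ (g₂ z'))) = g₁ (g₂ z')) :
    ((S.induced g₁).induced g₂).Isomorphic (T.induced g') := by
  have h1 : ∀ y', ∃ z, g₁ (g₂ z) = Ψ (g' y') := fun y' => (hrange _).2 ⟨y', rfl⟩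
  choose Ψ' hΨ' using h1
  have hbij : Function.Bijective Ψ' := by
    constructor
    · intro a b hab
      exact hg' (hinj (by rw [← hΨ', ← hΨ', hab]))
    · intro z
      obtain ⟨U, hzU, ρ, -, hρ⟩ := hloc z
      obtain ⟨y', hy'⟩ := (hrange (ρ (g₁ (g₂ z)))).1 ⟨z, (hρ z hzU).symm⟩
      refine ⟨y', hg ?_⟩
      simp only [Function.comp_apply, hΨ', hy', hρ z hzU]
  refine ⟨(Equiv.ofBijective Ψ' hbij).symm, ?_, ?_⟩
  · refine isMorphism_of_local fun z => ?_
    obtain ⟨U, hzU, ρ, hρm, hρ⟩ := hloc z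
    refine ⟨g₂ ⁻¹' (g₁ ⁻¹' U), hzU, isMorphismOn_induced ?_⟩
    -- On points of `Z` the local inverse `ρ` agrees with the global inverse, because `Ψ` is
    -- injective. Its values off `Z` play no role.
    refine IsMorphismOn.congr ((hρm.comp_isMorphism (isMorphism_induced_map S g₁)).comp_isMorphism
      (isMorphism_induced_map _ g₂)) fun z' hz' => hinj ?_
    obtain ⟨y', rfl⟩ := hbij.2 z'
    rw [Function.comp_apply, Function.comp_apply, Function.comp_apply, hρ _ hz', hΨ']
    congr 2
    exact ((Equiv.ofBijective Ψ' hbij).symm_apply_apply y').symm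
  · refine isMorphism_induced (isMorphism_induced ?_)
    have : g₁ ∘ g₂ ∘ (Equiv.ofBijective Ψ' hbij).symm.symm = Ψ ∘ g' := funext hΨ'
    rw [this]
    exact hΨ.comp (isMorphism_induced_map T g')

/-! ### Graphs and preimages: the two kinds of points of the Grassmannian. -/

section

open FunSpace

variable {E : Type*} [AddCommGroup E] [Module ℂ E] {e₀ : E}
  {F : Type*} [AddCommGroup F] [Module ℂ F] (P : Splitting e₀ F) {k : ℕ}

namespace Splitting

/-! ### Graphs of linear forms -/

theorem ne_zero {e₀ : E} (P : Splitting e₀ F) : e₀ ≠ 0 := by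
  intro h
  exact zero_ne_one ((map_zero P.lam).symm.trans ((congrArg P.lam h).symm.trans P.lam_self))

theorem sec_p (x : E) : P.sec (P.p x) = x - P.lam x • e₀ :=
  eq_sub_of_add_eq (P.decomp x)

theorem eq_smul_of_p_eq_zero {x : E} (h : P.p x = 0) : x = P.lam x • e₀ := by
  conv_lhs => rw [← P.decomp x, h, map_zero, zero_add]

theorem p_surjective : Function.Surjective P.p := fun w => ⟨P.sec w, P.p_sec w⟩

theorem p_add_smul (w : F) (c : ℂ) : P.p (P.sec w + c • e₀) = w := by
  rw [map_add, map_smul, P.p_sec, P.p_self, smul_zero, add_zero]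

theorem lam_add_smul (w : F) (c : ℂ) : P.lam (P.sec w + c • e₀) = c := by
  rw [map_add, map_smul, P.lam_sec, P.lam_self, zero_add, smul_eq_mul, mul_one]

/-- The map whose image is the graph of a linear form on a subspace of `F`. -/
def graphMap (W : Submodule ℂ F) (φ : Module.Dual ℂ W) : W →ₗ[ℂ] E :=
  P.sec ∘ₗ W.subtype + φ.smulRight e₀

/-- The graph of a linear form on a subspace of `F`. -/
def graph (W : Submodule ℂ F) (φ : Module.Dual ℂ W) : Submodule ℂ E :=
  LinearMap.range (P.graphMap W φ)

theorem graphMap_apply (W : Submodule ℂ F) (φ : Module.Dual ℂ W) (w : W) :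
    P.graphMap W φ w = P.sec w + φ w • e₀ := rfl

theorem p_graphMap (W : Submodule ℂ F) (φ : Module.Dual ℂ W) (w : W) :
    P.p (P.graphMap W φ w) = w := P.p_add_smul _ _

theorem graphMap_injective (W : Submodule ℂ F) (φ : Module.Dual ℂ W) :
    Function.Injective (P.graphMap W φ) := by
  intro x y h
  have := congrArg P.p h
  rw [graphMap_apply, graphMap_apply, p_add_smul, p_add_smul] at this
  exact Subtype.ext this

theorem mem_graph {W : Submodule ℂ F} {φ : Module.Dual ℂ W} {x : E} :
    x ∈ P.graph W φ ↔ ∃ h : P.p x ∈ W, P.lam x = φ ⟨P.p x, h⟩ := by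
  constructor
  · rintro ⟨w, rfl⟩
    have h := P.p_graphMap W φ w
    refine ⟨h ▸ w.2, ?_⟩
    exact (P.lam_add_smul _ _).trans (congrArg φ (Subtype.ext h.symm))
  · rintro ⟨h, hx⟩
    refine ⟨⟨P.p x, h⟩, ?_⟩
    rw [graphMap_apply, ← hx, P.decomp]

theorem finrank_graph (W : Submodule ℂ F) (φ : Module.Dual ℂ W) :
    Module.finrank ℂ (P.graph W φ) = Module.finrank ℂ W :=
  LinearMap.finrank_range_of_inj (P.graphMap_injective W φ)

theorem notMem_graph (W : Submodule ℂ F) (φ : Module.Dual ℂ W) : e₀ ∉ P.graph W φ := by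
  rw [mem_graph]
  rintro ⟨h, h'⟩
  have : (⟨P.p e₀, h⟩ : W) = 0 := Subtype.ext P.p_self
  rw [this, map_zero, P.lam_self] at h'
  exact one_ne_zero h'

theorem map_graph (W : Submodule ℂ F) (φ : Module.Dual ℂ W) : (P.graph W φ).map P.p = W := by
  ext w
  constructor
  · rintro ⟨x, hx, rfl⟩
    exact (P.mem_graph.1 hx).1
  · intro hw
    exact ⟨_, ⟨⟨w, hw⟩, rfl⟩, P.p_add_smul _ _⟩

theorem graph_injective {W : Submodule ℂ F} {φ ψ : Module.Dual ℂ W}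
    (h : P.graph W φ = P.graph W ψ) : φ = ψ := by
  ext w
  have h1 : P.graphMap W φ w ∈ P.graph W ψ := h ▸ ⟨w, rfl⟩
  obtain ⟨h2, h3⟩ := P.mem_graph.1 h1
  exact ((P.lam_add_smul _ _).symm.trans h3).trans
    (congrArg ψ (Subtype.ext (P.p_add_smul _ _)))

theorem mem_graph_domRestrict {W : Submodule ℂ F} {φ : Module.Dual ℂ F} {w : F} (hw : w ∈ W) :
    P.sec w + φ w • e₀ ∈ P.graph W (φ.domRestrict W) := ⟨⟨w, hw⟩, rfl⟩

theorem finrank_comap [FiniteDimensional ℂ F] (W : Submodule ℂ F) :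
    Module.finrank ℂ (W.comap P.p) = Module.finrank ℂ W + 1 := by
  let f : (W × ℂ) →ₗ[ℂ] E := (P.sec ∘ₗ W.subtype).coprod (LinearMap.toSpanSingleton ℂ E e₀)
  have hf : ∀ a, f a = P.sec a.1 + a.2 • e₀ := fun a => rfl
  have hinj : Function.Injective f := by
    rintro ⟨w, c⟩ ⟨w', c'⟩ h
    rw [hf, hf] at h
    have h1 := congrArg P.p h
    have h2 := congrArg P.lam h
    rw [p_add_smul, p_add_smul] at h1
    rw [lam_add_smul, lam_add_smul] at h2
    exact Prod.ext (Subtype.ext h1) h2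
  have hrange : LinearMap.range f = W.comap P.p := by
    ext x
    constructor
    · rintro ⟨⟨w, c⟩, rfl⟩
      rw [hf, Submodule.mem_comap, p_add_smul]
      exact w.2
    · intro hx
      exact ⟨(⟨P.p x, hx⟩, P.lam x), P.decomp x⟩
  rw [← hrange, LinearMap.finrank_range_of_inj hinj, Module.finrank_prod, Module.finrank_self]

theorem linearIndependent_of_p {u : Fin k → E} (h : LinearIndependent ℂ fun s => P.p (u s)) :
    LinearIndependent ℂ u := LinearIndependent.of_comp P.p h

/-- The kernel of `p` is the line of `e₀`, which meets the span only in zero. -/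
theorem linearIndependent_p {u : Fin k → E} (h : LinearIndependent ℂ u)
    (he : e₀ ∉ Submodule.span ℂ (Set.range u)) : LinearIndependent ℂ fun s => P.p (u s) := by
  refine h.map ?_
  rw [Submodule.disjoint_def]
  intro x hx hx'
  have h1 := P.eq_smul_of_p_eq_zero hx'
  by_cases hl : P.lam x = 0
  · rw [h1, hl, zero_smul]
  · refine absurd ?_ he
    rw [h1] at hx
    exact (Submodule.smul_mem_iff _ hl).1 hx

end Splitting

/-! ### Charts of Grassmannians -/

theorem Gr.isOpen_isChart (a : Fin k → Module.Dual ℂ E) :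
    IsOpen[(Gr.space E k).top] {V : Gr E k | IsChart a V.1} := by
  have h := OddSymplectic.isOpen_isChart (S := frameSpace E k) (v := fun v => v.1)
    (@isOpen_univ _ (frameSpace E k).top) (fun s => regVec_frame _ s) (fun v => v.2) a
  simp only [Set.mem_univ, true_and] at h
  exact h

theorem Gr.regVec_chartInv (a : Fin k → Module.Dual ℂ E) (c : Fin k → ℂ) :
    (Gr.space E k).RegVec {V : Gr E k | IsChart a V.1} (fun V => chartInv a V.1 c) :=
  OddSymplectic.regVec_chartInv (S := frameSpace E k) (v := fun v => v.1) (Gr.isOpen_isChart a)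
    (fun s => regVec_frame _ s) (fun v => v.2) a (fun _ hv => hv) c

/-! ### Subspaces that do not contain the kernel -/

namespace Splitting

/-- The graph of a linear form, as a map from the total space of the dual tautological bundle. -/
def grGraph (x : Gr.DualTaut F k) : Gr E k :=
  ⟨P.graph x.1.1 x.2, (P.finrank_graph _ _).trans x.1.2⟩

/-- The frame of the graph of a linear form given by a frame of its domain. -/
def graphFrame (a : Frame F k × Module.Dual ℂ F) : Frame E k :=
  ⟨fun s => P.sec (a.1.1 s) + a.2 (a.1.1 s) • e₀, P.linearIndependent_of_p (by
    simpa only [p_add_smul] using a.1.2)⟩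

theorem grGraph_injective : Function.Injective (P.grGraph (k := k)) := by
  rintro ⟨W, φ⟩ ⟨W', φ'⟩ h
  have h1 : P.graph W.1 φ = P.graph W'.1 φ' := congrArg Subtype.val h
  have h2 : W = W' := Subtype.ext (by rw [← P.map_graph W.1 φ, h1, P.map_graph])
  subst h2
  rw [P.graph_injective h1]

/-- Forms pulled back along `p` vanish at `e₀`, so they cannot be coordinates on a subspace
containing it. Such charts are what makes the avoiding stratum open. -/
theorem notMem_of_isChart {b : Fin k → Module.Dual ℂ F} {V : Submodule ℂ E}
    (h : IsChart (fun t => b t ∘ₗ P.p) V) : e₀ ∉ V := fun he =>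
  P.ne_zero (h.eq_of_apply_eq he V.zero_mem fun t => by simp [P.p_self])

variable [FiniteDimensional ℂ E]

theorem grGraph_ofFrame (a : Frame F k × Module.Dual ℂ F) :
    P.grGraph ⟨Gr.ofFrame a.1, a.2.domRestrict (Gr.ofFrame a.1).1⟩
      = Gr.ofFrame (P.graphFrame a) :=
  (Gr.ofFrame_eq fun s => P.mem_graph_domRestrict (Gr.mem_ofFrame a.1 s)).symm

theorem isMorphism_grGraph [FiniteDimensional ℂ F] : (Gr.dualTautSpace F k).IsMorphism (Gr.space E k) P.grGraph := by
  refine isMorphism_coinduced ?_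
  have h : (P.grGraph ∘ fun a : Frame F k × Module.Dual ℂ F =>
      (⟨Gr.ofFrame a.1, a.2.domRestrict (Gr.ofFrame a.1).1⟩ : Gr.DualTaut F k))
      = Gr.ofFrame ∘ P.graphFrame := funext fun a => P.grGraph_ofFrame a
  rw [h]
  refine (isMorphism_coinduced_mk _ _).comp (isMorphismOn_univ.1 (isMorphismOn_frameSpace
    (@isOpen_univ _ (frameDualSpace F k).top) fun s => ?_))
  exact ((regVec_frameDual_frame _ s).map P.sec).add
    (RegVec.smul ((regVec_frameDual_dual _).apply (regVec_frameDual_frame _ s))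
      (regVec_const _ _))

/-- Linear forms on `F`, whose pullbacks are coordinates near a subspace that does not contain the
kernel. -/
theorem exists_isChart_comp_p {V : Gr E k} (hV : e₀ ∉ V.1) :
    ∃ b : Fin k → Module.Dual ℂ F, IsChart (fun t => b t ∘ₗ P.p) V.1 := by
  obtain ⟨v, rfl⟩ := Gr.exists_frame V
  obtain ⟨b, hb⟩ := exists_dual_functionals (P.linearIndependent_p v.2 hV)
  exact ⟨b, isChart_of_dual hb⟩

theorem grGraph_local [FiniteDimensional ℂ F] (V : Gr E k) (hV : e₀ ∉ V.1) :
    ∃ U, V ∈ U ∧ ∃ ρ : Gr E k → Gr.DualTaut F k,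
      (Gr.space E k).IsMorphismOn (Gr.dualTautSpace F k) U ρ ∧
      ∀ V' ∈ U, P.grGraph (ρ V') = V' := by
  classical
  obtain ⟨b, hb⟩ := P.exists_isChart_comp_p hV
  let a : Fin k → Module.Dual ℂ E := fun t => b t ∘ₗ P.p
  let w : Gr E k → Fin k → E := fun V' s => chartInv a V'.1 (Pi.single s 1)
  -- A form on all of `F`: take the point of `V'` with the same `b`-coordinates, then its
  -- `lam`-coordinate. On the image of `V'` it restricts to the form whose graph is `V'`.
  let φ : Gr E k → Module.Dual ℂ F := fun V' => P.lam ∘ₗ chartInv a V'.1 ∘ₗ LinearMap.pi b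
  let U : Set (Gr E k) := {V' | IsChart a V'.1}
  have hli : ∀ V' ∈ U, LinearIndependent ℂ fun s => P.p (w V' s) := by
    intro V' hV'
    refine linearIndependent_of_lowerTriangular (a := b) (fun t s hts => ?_) fun s => ?_
    · exact (hV'.apply_chartInv _ t).trans (Pi.single_eq_of_ne hts.ne _)
    · exact (hV'.apply_chartInv _ s).trans (Pi.single_eq_same _ _)
  obtain ⟨τ, hτ, hτU⟩ := exists_isMorphismOn_frameDualSpace (Gr.isOpen_isChart a) hb
    (fun s => (Gr.regVec_chartInv a (Pi.single s 1)).map P.p)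
    (φ := φ) (RegVec.dual fun x => Gr.regVec_chartInv a (fun t => b t x) P.lam) hli
  refine ⟨U, hb, _, ((isMorphism_coinduced_mk _ _).comp_isMorphismOn hτ), fun V' hV' => ?_⟩
  refine (P.grGraph_ofFrame (τ V')).trans (Gr.ofFrame_eq fun s => ?_)
  obtain ⟨h1, h2⟩ := hτU V' hV'
  have hw : w V' s ∈ V'.1 := chartInv_mem _ _ _
  have h3 : φ V' (P.p (w V' s)) = P.lam (w V' s) :=
    congrArg P.lam (hV'.chartInv_eq hw fun t => rfl)
  change P.sec ((τ V').1.1 s) + (τ V').2 ((τ V').1.1 s) • e₀ ∈ V'.1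
  rw [h1, h2, h3, P.decomp]
  exact hw

end Splitting

/-! ### Subspaces that contain the kernel -/

namespace Splitting

/-- The preimage in `E` of a subspace of `F`. -/
def grComap [FiniteDimensional ℂ F] (W : Gr F k) : Gr E (k + 1) :=
  ⟨W.1.comap P.p, by rw [P.finrank_comap, W.2]⟩

/-- The frame of the preimage of a subspace given by a frame of the subspace. -/
def comapFrame (v : Frame F k) : Frame E (k + 1) :=
  ⟨Fin.cons e₀ fun s => P.sec (v.1 s), by
    have h : LinearIndependent ℂ fun s => P.sec (v.1 s) :=
      P.linearIndependent_of_p (by simpa only [P.p_sec] using v.2)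
    refine linearIndependent_finCons.2 ⟨h, fun he => ?_⟩
    have hle : Submodule.span ℂ (Set.range fun s => P.sec (v.1 s)) ≤ LinearMap.ker P.lam := by
      refine Submodule.span_le.2 ?_
      rintro _ ⟨s, rfl⟩
      exact P.lam_sec _
    exact one_ne_zero (P.lam_self.symm.trans (hle he))⟩

theorem comap_map {V : Submodule ℂ E} (h : e₀ ∈ V) : (V.map P.p).comap P.p = V := by
  refine le_antisymm ?_ (Submodule.le_comap_map _ _)
  rintro x ⟨y, hy, hxy⟩
  have h1 : P.p (x - y) = 0 := by rw [map_sub, hxy, sub_self]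
  rw [← sub_add_cancel x y, P.eq_smul_of_p_eq_zero h1]
  exact V.add_mem (V.smul_mem _ h) hy

variable [FiniteDimensional ℂ F]

theorem grComap_injective : Function.Injective (P.grComap (k := k)) := fun _ _ h =>
  Subtype.ext (Submodule.comap_injective_of_surjective P.p_surjective (congrArg Subtype.val h))

theorem exists_grComap_eq {V : Gr E (k + 1)} (hV : e₀ ∈ V.1) : ∃ W, P.grComap W = V := by
  have h : Module.finrank ℂ (V.1.map P.p) = k := by
    have := P.finrank_comap (V.1.map P.p)
    rw [P.comap_map hV, V.2] at this
    omega
  exact ⟨⟨_, h⟩, Subtype.ext (P.comap_map hV)⟩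

variable [FiniteDimensional ℂ E]

theorem grComap_ofFrame (v : Frame F k) :
    P.grComap (Gr.ofFrame v) = Gr.ofFrame (P.comapFrame v) := by
  refine (Gr.ofFrame_eq fun s => ?_).symm
  refine Fin.cases ?_ (fun s => ?_) s
  · change P.p e₀ ∈ (Gr.ofFrame v).1
    rw [P.p_self]
    exact zero_mem _
  · change P.p (P.sec (v.1 s)) ∈ (Gr.ofFrame v).1
    rw [P.p_sec]
    exact Gr.mem_ofFrame v s

theorem isMorphism_grComap : (Gr.space F k).IsMorphism (Gr.space E (k + 1)) P.grComap := by
  refine isMorphism_coinduced ?_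
  rw [show P.grComap ∘ Gr.ofFrame = Gr.ofFrame ∘ P.comapFrame from funext P.grComap_ofFrame]
  refine (isMorphism_coinduced_mk _ _).comp (isMorphismOn_univ.1 (isMorphismOn_frameSpace
    (@isOpen_univ _ (frameSpace F k).top) fun s => ?_))
  refine Fin.cases (regVec_const _ _) (fun s => ?_) s
  exact (regVec_frame _ s).map P.sec

theorem grComap_local (V : Gr E (k + 1)) (hV : e₀ ∈ V.1) :
    ∃ U, V ∈ U ∧ ∃ ρ : Gr E (k + 1) → Gr F k,
      (Gr.space E (k + 1)).IsMorphismOn (Gr.space F k) U ρ ∧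
      ∀ V' ∈ U, e₀ ∈ V'.1 → P.grComap (ρ V') = V' := by
  classical
  obtain ⟨W, rfl⟩ := P.exists_grComap_eq hV
  obtain ⟨v, rfl⟩ := Gr.exists_frame W
  obtain ⟨a, ha⟩ := exists_dual_functionals (P.comapFrame v).2
  have hb : IsChart a (P.grComap (Gr.ofFrame v)).1 := by
    rw [P.grComap_ofFrame]
    exact isChart_of_dual ha
  -- The frame dual to `a` begins with `e₀`, so the remaining forms factor through `p` and act as
  -- coordinates on subspaces of `F`.
  have ha0 : ∀ t : Fin k, a t.succ e₀ = 0 := fun t => by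
    simpa [comapFrame] using ha t.succ 0
  have hap : ∀ (t : Fin k) x, a t.succ (P.sec (P.p x)) = a t.succ x := fun t x => by
    rw [P.sec_p, map_sub, map_smul, ha0, smul_zero, sub_zero]
  let w : Gr E (k + 1) → Fin k → E := fun V' s => chartInv a V'.1 (Pi.single s.succ 1)
  let U : Set (Gr E (k + 1)) := {V' | IsChart a V'.1}
  have hli : ∀ V' ∈ U, LinearIndependent ℂ fun s => P.p (w V' s) := by
    intro V' hV'
    refine linearIndependent_of_lowerTriangular (a := fun t => a t.succ ∘ₗ P.sec)
      (fun t s hts => ?_) fun s => ?_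
    · refine (hap _ _).trans ((hV'.apply_chartInv _ _).trans (Pi.single_eq_of_ne ?_ _))
      exact fun h => hts.ne (Fin.succ_injective _ h)
    · exact (hap _ _).trans ((hV'.apply_chartInv _ _).trans (Pi.single_eq_same _ _))
  obtain ⟨τ, hτ, hτU⟩ := exists_isMorphismOn_frameSpace (Gr.isOpen_isChart a) hb
    (fun s => (Gr.regVec_chartInv a (Pi.single s.succ 1)).map P.p) hli
  -- The local inverse is defined on the whole chart, but it is required to invert `grComap` only
  -- where `e₀ ∈ V'`.
  refine ⟨U, hb, _, ((isMorphism_coinduced_mk _ _).comp_isMorphismOn hτ), fun V' hV' he => ?_⟩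
  refine (P.grComap_ofFrame (τ V')).trans (Gr.ofFrame_eq fun s => ?_)
  refine Fin.cases he (fun s => ?_) s
  change P.sec ((τ V').1 s) ∈ V'.1
  rw [hτU V' hV', P.sec_p]
  exact V'.1.sub_mem (chartInv_mem _ _ _) (V'.1.smul_mem _ he)

end Splitting

end

/-! ### Flags: charts, and the strata according to the step at which `e₀` enters. -/

section

open FunSpace

variable {E : Type*} [AddCommGroup E] [Module ℂ E] {e₀ : E}
  {F : Type*} [AddCommGroup F] [Module ℂ F] (P : Splitting e₀ F) {n m : ℕ}

/-! ### Charts of flag manifolds -/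

/-- The first `j` members of a family. -/
def initialFamily {α : Type*} (a : Fin m → α) (j : Fin (m + 1)) : Fin j → α :=
  fun t => a (t.castLE (Nat.le_of_lt_succ j.2))

/-- The flags on each member of which an initial part of the linear forms `a` are coordinates. -/
def Flag.chart (a : Fin m → Module.Dual ℂ E) : Set (Flag E m) :=
  {V | ∀ j, IsChart (initialFamily a j) (V.V j)}

theorem linearIndependent_initialFamily (v : Frame E m) (j : Fin (m + 1)) :
    LinearIndependent ℂ (initialFamily v.1 j) :=
  v.2.comp (fun s : Fin j => s.castLE (Nat.le_of_lt_succ j.2)) (Fin.castLE_injective _)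

theorem Flag.isOpen_chart (a : Fin m → Module.Dual ℂ E) :
    IsOpen[(Flag.space E m).top] (Flag.chart a) := by
  have h : ∀ j, IsOpen[(frameSpace E m).top] {v : Frame E m |
      IsChart (initialFamily a j) (Submodule.span ℂ (Set.range (initialFamily v.1 j)))} := by
    intro j
    have h := isOpen_isChart (S := frameSpace E m) (v := fun v => initialFamily v.1 j)
      (@isOpen_univ _ (frameSpace E m).top) (fun _ => regVec_frame _ _)
      (fun v => linearIndependent_initialFamily v j) (initialFamily a j)
    simp only [Set.mem_univ, true_and] at h
    exact h
  have h' := @isOpen_iInter_of_finite _ _ (frameSpace E m).top _ _ h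
  rw [← Set.ofPred_forall] at h'
  exact h'

theorem Flag.regVec_chartInv (a : Fin m → Module.Dual ℂ E) (j : Fin (m + 1)) (c : Fin j → ℂ) :
    (Flag.space E m).RegVec (Flag.chart a)
      (fun V => chartInv (initialFamily a j) (V.V j) c) :=
  OddSymplectic.regVec_chartInv (S := frameSpace E m) (v := fun v => initialFamily v.1 j)
    (Flag.isOpen_chart a) (fun _ => regVec_frame _ _)
    (fun v => linearIndependent_initialFamily v j) (initialFamily a j) (fun _ hv => hv j) c

theorem Flag.ofFrame_mem_chart {a : Fin m → Module.Dual ℂ E} {v : Frame E m}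
    (h : ∀ t s, a t (v.1 s) = if t = s then 1 else 0) : Flag.ofFrame v ∈ Flag.chart a :=
  fun j => isChart_of_dual (v := initialFamily v.1 j) fun t s => by
    simp only [initialFamily, h, (Fin.castLE_injective _).eq_iff]

/-- The vectors of a frame of a flag that is normalized with respect to the linear forms `a`. -/
noncomputable def Flag.normalFrame (a : Fin m → Module.Dual ℂ E) (V : Flag E m) (s : Fin m) : E :=
  chartInv (initialFamily a s.succ) (V.V s.succ) fun t => if (t : ℕ) = s then 1 else 0

theorem Flag.normalFrame_mem (a : Fin m → Module.Dual ℂ E) (V : Flag E m) (s : Fin m) :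
    Flag.normalFrame a V s ∈ V.V s.succ := chartInv_mem _ _ _

/-- The coordinates on `V.V s.succ` are the forms of index at most `s`, so nothing is prescribed for
`t > s`; the evaluation matrix is merely triangular. -/
theorem Flag.apply_normalFrame {a : Fin m → Module.Dual ℂ E} {V : Flag E m}
    (hV : V ∈ Flag.chart a) {t s : Fin m} (hts : t ≤ s) :
    a t (Flag.normalFrame a V s) = if t = s then 1 else 0 := by
  refine ((hV s.succ).apply_chartInv _ ⟨t, Nat.lt_succ_of_le hts⟩).trans ?_
  simp only [Fin.ext_iff]

/-! ### Strata of the flag manifold -/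

/-- Separates the members before `e₀` enters from those after; in either case `j'` is the index of
the corresponding member of the flag in `F`. -/
theorem exists_castSucc_or_succ (i : Fin (n + 1)) (j : Fin (n + 2)) :
    (∃ j', j' ≤ i ∧ j = Fin.castSucc j') ∨ ∃ j', i ≤ j' ∧ j = Fin.succ j' := by
  rcases le_or_gt j i.castSucc with h | h
  · refine Or.inl ⟨⟨j, lt_of_le_of_lt h i.2⟩, h, rfl⟩
  · obtain ⟨j', rfl⟩ := Fin.exists_succ_eq.2 (Fin.ne_zero_of_lt h)
    exact Or.inr ⟨j', Fin.castSucc_lt_succ_iff.1 h, rfl⟩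

namespace Splitting

/-- The members of the flag in `E` given by a flag in `F` and a linear form on its `i`-th
member. -/
def flagGraphAux (i : Fin (n + 1)) (x : Flag.DualTaut F n i) (j : Fin (n + 2)) : Submodule ℂ E :=
  -- `i.predAbove j` is `j` up to `i` and `j - 1` beyond, since projection loses a dimension once
  -- `e₀` has entered. The graph condition applies only before that.
  (x.1.V (i.predAbove j)).comap P.p ⊓ (if j ≤ i.castSucc then P.graph (x.1.V i) x.2 else ⊤)

theorem mem_flagGraphAux_castSucc {i j : Fin (n + 1)} (h : j ≤ i) {x : Flag.DualTaut F n i}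
    {y : E} : y ∈ P.flagGraphAux i x j.castSucc ↔ P.p y ∈ x.1.V j ∧ y ∈ P.graph (x.1.V i) x.2 := by
  rw [flagGraphAux, Fin.predAbove_castSucc_of_le _ _ h,
    if_pos (Fin.castSucc_le_castSucc_iff.2 h), Submodule.mem_inf, Submodule.mem_comap]

theorem mem_flagGraphAux_succ {i j : Fin (n + 1)} (h : i ≤ j) {x : Flag.DualTaut F n i}
    {y : E} : y ∈ P.flagGraphAux i x j.succ ↔ P.p y ∈ x.1.V j := by
  rw [flagGraphAux, Fin.predAbove_succ_of_le _ _ h,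
    if_neg (not_le.2 (Fin.castSucc_lt_succ_iff.2 h)), inf_top_eq, Submodule.mem_comap]

theorem linearIndependent_insertNth {v : Fin n → F} (hv : LinearIndependent ℂ v) (c : Fin n → ℂ)
    (i : Fin (n + 1)) :
    LinearIndependent ℂ (i.insertNth e₀ fun t => P.sec (v t) + c t • e₀ : Fin (n + 1) → E) := by
  rw [Fintype.linearIndependent_iff]
  intro g hg
  rw [Fin.sum_univ_succAbove _ i] at hg
  simp only [Fin.insertNth_apply_same, Fin.insertNth_apply_succAbove] at hg
  have h1 := congrArg P.p hg
  simp only [map_add, map_smul, map_sum, P.p_self, P.p_sec, smul_zero, zero_add, add_zero,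
    map_zero] at h1
  have h2 := Fintype.linearIndependent_iff.1 hv _ h1
  simp only [h2, zero_smul, Finset.sum_const_zero, add_zero] at hg
  intro j
  rcases Fin.eq_self_or_eq_succAbove i j with rfl | ⟨t, rfl⟩
  · exact (smul_eq_zero.1 hg).resolve_right P.ne_zero
  · exact h2 t

/-- The frame of a flag in `E` given by a frame in `F` and a linear form. -/
def flagFrame (i : Fin (n + 1)) (a : Frame F n × Module.Dual ℂ F) : Frame E (n + 1) :=
  -- After `e₀` has entered, multiples of `e₀` do not affect the span, so the coefficient there is
  -- set to zero.
  ⟨i.insertNth e₀ fun t => P.sec (a.1.1 t) + (if t.castSucc < i then a.2 (a.1.1 t) else 0) • e₀,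
    P.linearIndependent_insertNth a.1.2 _ i⟩

theorem flagFrame_self (i : Fin (n + 1)) (a : Frame F n × Module.Dual ℂ F) :
    (P.flagFrame i a).1 i = e₀ := by
  simp only [flagFrame, Fin.insertNth_apply_same]

theorem flagFrame_castSucc {i : Fin (n + 1)} {t : Fin n} (h : t.castSucc < i)
    (a : Frame F n × Module.Dual ℂ F) :
    (P.flagFrame i a).1 t.castSucc = P.sec (a.1.1 t) + a.2 (a.1.1 t) • e₀ := by
  conv_lhs => rw [← Fin.succAbove_of_castSucc_lt i t h]
  simp only [flagFrame, Fin.insertNth_apply_succAbove, if_pos h]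

theorem flagFrame_succ {i : Fin (n + 1)} {t : Fin n} (h : i ≤ t.castSucc)
    (a : Frame F n × Module.Dual ℂ F) :
    (P.flagFrame i a).1 t.succ = P.sec (a.1.1 t) := by
  conv_lhs => rw [← Fin.succAbove_of_le_castSucc i t h]
  simp only [flagFrame, Fin.insertNth_apply_succAbove, if_neg (not_lt.2 h), zero_smul, add_zero]

theorem forall_fin_of_flagFrame {i : Fin (n + 1)} {p : Fin (n + 1) → Prop} (h0 : p i)
    (h1 : ∀ t : Fin n, t.castSucc < i → p t.castSucc) (h2 : ∀ t : Fin n, i ≤ t.castSucc → p t.succ)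
    (s : Fin (n + 1)) : p s := by
  rcases Fin.eq_self_or_eq_succAbove i s with rfl | ⟨t, rfl⟩
  · exact h0
  · rcases lt_or_ge t.castSucc i with h | h
    · rw [Fin.succAbove_of_castSucc_lt _ _ h]
      exact h1 t h
    · rw [Fin.succAbove_of_le_castSucc _ _ h]
      exact h2 t h

variable [FiniteDimensional ℂ F]

/-- The flag in `E` given by a flag in `F` and a linear form on its `i`-th member. -/
def flagGraph (i : Fin (n + 1)) (x : Flag.DualTaut F n i) : Flag E (n + 1) where
  V := P.flagGraphAux i x
  mono := by
    intro j j' h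
    refine inf_le_inf (Submodule.comap_mono (x.1.mono (Fin.predAbove_right_monotone i h))) ?_
    split_ifs with h1 h2 h2
    · exact le_rfl
    · exact le_top
    · exact absurd (h.trans h2) h1
    · exact le_rfl
  finrank_eq := by
    intro j
    rcases exists_castSucc_or_succ i j with ⟨j, hj, rfl⟩ | ⟨j, hj, rfl⟩
    · have h : P.flagGraphAux i x j.castSucc
          = ((x.1.V j).comap (x.1.V i).subtype).map (P.graphMap (x.1.V i) x.2) := by
        ext y
        rw [P.mem_flagGraphAux_castSucc hj]
        constructor
        · rintro ⟨h1, w, rfl⟩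
          rw [p_graphMap] at h1
          exact ⟨w, h1, rfl⟩
        · rintro ⟨w, hw, rfl⟩
          rw [p_graphMap]
          exact ⟨hw, w, rfl⟩
      rw [h, ← (Submodule.equivMapOfInjective _ (P.graphMap_injective _ _) _).finrank_eq,
        (Submodule.comapSubtypeEquivOfLe (x.1.mono hj)).finrank_eq, x.1.finrank_eq]
      rfl
    · have h : P.flagGraphAux i x j.succ = (x.1.V j).comap P.p :=
        Submodule.ext fun y => P.mem_flagGraphAux_succ hj
      rw [h, P.finrank_comap, x.1.finrank_eq, Fin.val_succ]

theorem mem_flagGraph_castSucc {i j : Fin (n + 1)} (h : j ≤ i) {x : Flag.DualTaut F n i} {y : E} :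
    y ∈ (P.flagGraph i x).V j.castSucc ↔ P.p y ∈ x.1.V j ∧ y ∈ P.graph (x.1.V i) x.2 :=
  P.mem_flagGraphAux_castSucc h

theorem mem_flagGraph_succ {i j : Fin (n + 1)} (h : i ≤ j) {x : Flag.DualTaut F n i} {y : E} :
    y ∈ (P.flagGraph i x).V j.succ ↔ P.p y ∈ x.1.V j :=
  P.mem_flagGraphAux_succ h

theorem p_mem_of_mem_flagGraph {i : Fin (n + 1)} {x : Flag.DualTaut F n i} {j : Fin (n + 2)}
    {y : E} (h : y ∈ (P.flagGraph i x).V j) : P.p y ∈ x.1.V (i.predAbove j) := h.1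

theorem self_mem_flagGraph (i : Fin (n + 1)) (x : Flag.DualTaut F n i) :
    e₀ ∈ (P.flagGraph i x).V i.succ := by
  rw [P.mem_flagGraph_succ le_rfl, P.p_self]
  exact zero_mem _

theorem self_notMem_flagGraph (i : Fin (n + 1)) (x : Flag.DualTaut F n i) :
    e₀ ∉ (P.flagGraph i x).V i.castSucc := fun h =>
  P.notMem_graph _ _ ((P.mem_flagGraph_castSucc le_rfl).1 h).2

theorem sec_mem_flagGraph_last (i : Fin (n + 1)) (x : Flag.DualTaut F n i) {j : Fin (n + 1)}
    {w : F} (hw : w ∈ x.1.V j) : P.sec w ∈ (P.flagGraph i x).V (Fin.last (n + 1)) := by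
  rw [← Fin.succ_last, P.mem_flagGraph_succ (Fin.le_last i), P.p_sec]
  exact x.1.mono (Fin.le_last j) hw

/-- The flag in `F` is recovered by projecting all members but one; the member at `i.castSucc` is
the graph itself and determines the form. -/
theorem flagGraph_injective (i : Fin (n + 1)) :
    Function.Injective (P.flagGraph (n := n) i) := by
  rintro ⟨W, φ⟩ ⟨W', φ'⟩ h
  have h1 : ∀ (W : Flag F n) (φ : Module.Dual ℂ (W.V i)) (j : Fin (n + 1)), W.V j
      = ((P.flagGraph i ⟨W, φ⟩).V (if j ≤ i then j.castSucc else j.succ)).map P.p := by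
    intro W φ j
    ext w
    split_ifs with hj
    · constructor
      · intro hw
        have hw' := W.mono hj hw
        exact ⟨P.sec w + φ ⟨w, hw'⟩ • e₀, (P.mem_flagGraph_castSucc hj).2
          ⟨by rwa [P.p_add_smul], ⟨w, hw'⟩, rfl⟩, P.p_add_smul _ _⟩
      · rintro ⟨y, hy, rfl⟩
        exact ((P.mem_flagGraph_castSucc hj).1 hy).1
    · constructor
      · intro hw
        exact ⟨P.sec w, (P.mem_flagGraph_succ (not_le.1 hj).le).2 (by rwa [P.p_sec]), P.p_sec w⟩
      · rintro ⟨y, hy, rfl⟩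
        exact (P.mem_flagGraph_succ (not_le.1 hj).le).1 hy
  have h2 : W = W' := Flag.ext (funext fun j => by rw [h1 W φ, h1 W' φ', h])
  subst h2
  have h3 : ∀ ψ : Module.Dual ℂ (W.V i), (P.flagGraph i ⟨W, ψ⟩).V i.castSucc = P.graph (W.V i) ψ :=
    fun ψ => Submodule.ext fun y => (P.mem_flagGraph_castSucc le_rfl).trans
      ⟨fun h => h.2, fun h => ⟨(P.mem_graph.1 h).1, h⟩⟩
  have h4 : P.graph (W.V i) φ = P.graph (W.V i) φ' := by rw [← h3, ← h3, h]
  rw [P.graph_injective h4]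

variable [FiniteDimensional ℂ E]

theorem flagGraph_ofFrame (i : Fin (n + 1)) (a : Frame F n × Module.Dual ℂ F) :
    P.flagGraph i ⟨Flag.ofFrame a.1, a.2.domRestrict ((Flag.ofFrame a.1).V i)⟩
      = Flag.ofFrame (P.flagFrame i a) := by
  refine (Flag.ofFrame_eq (forall_fin_of_flagFrame (i := i) ?_ (fun t ht => ?_)
    fun t ht => ?_)).symm
  · rw [flagFrame_self]
    exact P.self_mem_flagGraph _ _
  · rw [P.flagFrame_castSucc ht, Fin.succ_castSucc, P.mem_flagGraph_castSucc ht, P.p_add_smul]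
    exact ⟨Flag.mem_ofFrame _ (by simp), P.mem_graph_domRestrict (Flag.mem_ofFrame _ ht)⟩
  · rw [P.flagFrame_succ ht, P.mem_flagGraph_succ (ht.trans Fin.castSucc_lt_succ.le), P.p_sec]
    exact Flag.mem_ofFrame _ (by simp)

theorem isMorphism_flagGraph (i : Fin (n + 1)) :
    (Flag.dualTautSpace F n i).IsMorphism (Flag.space E (n + 1)) (P.flagGraph i) := by
  refine isMorphism_coinduced ?_
  have h : (P.flagGraph i ∘ fun a : Frame F n × Module.Dual ℂ F =>
      (⟨Flag.ofFrame a.1, a.2.domRestrict ((Flag.ofFrame a.1).V i)⟩ : Flag.DualTaut F n i))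
      = Flag.ofFrame ∘ P.flagFrame i := funext fun a => P.flagGraph_ofFrame i a
  rw [h]
  refine (isMorphism_coinduced_mk _ _).comp (isMorphismOn_univ.1 (isMorphismOn_frameSpace
    (@isOpen_univ _ (frameDualSpace F n).top)
    (forall_fin_of_flagFrame (i := i) ?_ (fun t ht => ?_) fun t ht => ?_)))
  · simp only [flagFrame_self]
    exact regVec_const _ _
  · simp only [P.flagFrame_castSucc ht]
    exact ((regVec_frameDual_frame _ t).map P.sec).add
      (RegVec.smul ((regVec_frameDual_dual _).apply (regVec_frameDual_frame _ t))
        (regVec_const _ _))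
  · simp only [P.flagFrame_succ ht]
    exact (regVec_frameDual_frame _ t).map P.sec

/-- With `e₀` as the `i`-th frame vector, the dual forms of index other than `i` kill `e₀` and
factor through `p`. The first `i` of them are coordinates on the member at `i.castSucc`, which
therefore avoids `e₀` throughout the chart; only the condition at `i.succ` has to be imposed. -/
theorem flagGraph_local (i : Fin (n + 1)) (V : Flag E (n + 1)) (hV : e₀ ∈ V.V i.succ)
    (hV' : e₀ ∉ V.V i.castSucc) :
    ∃ U, V ∈ U ∧ ∃ ρ : Flag E (n + 1) → Flag.DualTaut F n i,
      (Flag.space E (n + 1)).IsMorphismOn (Flag.dualTautSpace F n i) U ρ ∧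
      ∀ V' ∈ U, e₀ ∈ V'.V i.succ → P.flagGraph i (ρ V') = V' := by
  obtain ⟨v, hvi, rfl⟩ := V.exists_frame_apply_eq i e₀ hV hV'
  obtain ⟨a, ha⟩ := exists_dual_functionals v.2
  have hb := Flag.ofFrame_mem_chart ha
  have ha0 : ∀ t, t ≠ i → ∀ x, a t (P.sec (P.p x)) = a t x := fun t ht x => by
    rw [P.sec_p, map_sub, map_smul, (congrArg (a t) hvi).symm.trans (ha t i), if_neg ht,
      smul_zero, sub_zero]
  let w : Flag E (n + 1) → Fin (n + 1) → E := fun V' => Flag.normalFrame a V'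
  -- As for Grassmannians: lift to the member at `i.castSucc` by its coordinates, then read off
  -- `lam`.
  let φ : Flag E (n + 1) → Module.Dual ℂ F := fun V' =>
    P.lam ∘ₗ chartInv (initialFamily a i.castSucc) (V'.V i.castSucc) ∘ₗ
      LinearMap.pi (initialFamily a i.castSucc) ∘ₗ P.sec
  have hli : ∀ V' ∈ Flag.chart a,
      LinearIndependent ℂ fun t : Fin n => P.p (w V' (i.succAbove t)) := by
    intro V' hV'
    refine linearIndependent_of_lowerTriangular (a := fun t => a (i.succAbove t) ∘ₗ P.sec)
      (fun t s hts => ?_) fun s => ?_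
    · have hlt : i.succAbove t < i.succAbove s := Fin.strictMono_succAbove i hts
      exact (ha0 _ (Fin.succAbove_ne _ _) _).trans
        ((Flag.apply_normalFrame hV' hlt.le).trans (if_neg hlt.ne))
    · exact (ha0 _ (Fin.succAbove_ne _ _) _).trans
        ((Flag.apply_normalFrame hV' le_rfl).trans (if_pos rfl))
  obtain ⟨τ, hτ, hτU⟩ := exists_isMorphismOn_frameDualSpace (Flag.isOpen_chart a) hb
    (w := fun V' t => P.p (w V' (i.succAbove t)))
    (fun t => (Flag.regVec_chartInv a (i.succAbove t).succ _).map P.p)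
    (φ := φ) (RegVec.dual fun x => Flag.regVec_chartInv a i.castSucc _ P.lam) hli
  refine ⟨_, hb, _, (isMorphism_coinduced_mk _ _).comp_isMorphismOn hτ, fun V' hV' he => ?_⟩
  obtain ⟨h1, h2⟩ := hτU V' hV'
  refine (P.flagGraph_ofFrame i (τ V')).trans
    (Flag.ofFrame_eq (forall_fin_of_flagFrame (i := i) ?_ (fun t ht => ?_) fun t ht => ?_))
  · rwa [flagFrame_self]
  · rw [P.flagFrame_castSucc ht, h1, h2]
    beta_reduce
    rw [Fin.succAbove_of_castSucc_lt _ _ ht]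
    have hw : w V' t.castSucc ∈ V'.V t.castSucc.succ := Flag.normalFrame_mem _ _ _
    have h3 : φ V' (P.p (w V' t.castSucc)) = P.lam (w V' t.castSucc) :=
      congrArg P.lam ((hV' i.castSucc).chartInv_eq
        (V'.mono (show t.castSucc.succ ≤ i.castSucc from ht) hw)
        fun s => (ha0 _ (Fin.ne_of_lt s.2) _).symm)
    rwa [h3, P.decomp]
  · rw [P.flagFrame_succ ht, h1]
    beta_reduce
    rw [Fin.succAbove_of_le_castSucc _ _ ht, P.sec_p]
    exact (V'.V _).sub_mem (Flag.normalFrame_mem _ _ _) ((V'.V _).smul_mem _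
      (V'.mono (Fin.succ_le_succ_iff.2 (ht.trans Fin.castSucc_lt_succ.le)) he))

end Splitting

end

/-! ### Orbits -/

theorem orbits_eq_of_transitive {G X : Type*} [Group G] [MulAction G X] {𝒮 : Set (Set X)}
    (hne : ∀ s ∈ 𝒮, s.Nonempty) (hcover : ∀ x, ∃ s ∈ 𝒮, x ∈ s)
    (hinv : ∀ s ∈ 𝒮, ∀ x ∈ s, ∀ g : G, g • x ∈ s)
    (htrans : ∀ s ∈ 𝒮, ∀ x ∈ s, ∀ y ∈ s, ∃ g : G, g • x = y) : orbits G X = 𝒮 := by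
  have key : ∀ s ∈ 𝒮, ∀ x ∈ s, MulAction.orbit G x = s := by
    intro s hs x hx
    ext y
    constructor
    · rintro ⟨g, rfl⟩
      exact hinv s hs x hx g
    · intro hy
      exact htrans s hs x hx y hy
  ext s
  constructor
  · rintro ⟨x, rfl⟩
    obtain ⟨s, hs, hx⟩ := hcover x
    change MulAction.orbit G x ∈ 𝒮
    rwa [key s hs x hx]
  · intro hs
    obtain ⟨x, hx⟩ := hne s hs
    exact ⟨x, key s hs x hx⟩

/-! ### Isotropic strata: isomorphisms with bundles, and orbits of the group. -/

section

variable {E : Type*} [AddCommGroup E] [Module ℂ E] {e₀ : E}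
  {F : Type*} [AddCommGroup F] [Module ℂ F] {P : Splitting e₀ F}
  {ω : LinearMap.BilinForm ℂ E} {ωF : LinearMap.BilinForm ℂ F} {n k : ℕ}

namespace Splitting

/-! ### Isotropy in `E` and in `F` -/

theorem isIsotropic_of_p_mem (hP : ∀ x y, ωF (P.p x) (P.p y) = ω x y) {V : Submodule ℂ E}
    {W : Submodule ℂ F} (hW : IsIsotropic ωF W) (h : ∀ x ∈ V, P.p x ∈ W) : IsIsotropic ω V :=
  fun x hx y hy => by rw [← hP, hW _ (h x hx) _ (h y hy)]

theorem isIsotropic_of_exists (hP : ∀ x y, ωF (P.p x) (P.p y) = ω x y) {V : Submodule ℂ E}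
    {W : Submodule ℂ F} (hV : IsIsotropic ω V) (h : ∀ w ∈ W, ∃ x ∈ V, P.p x = w) :
    IsIsotropic ωF W := by
  intro w hw w' hw'
  obtain ⟨x, hx, rfl⟩ := h w hw
  obtain ⟨x', hx', rfl⟩ := h w' hw'
  rw [hP, hV x hx x' hx']

/-! ### The action of the odd symplectic group -/

/-- An isometry preserves the radical, which is the line of `e₀`. -/
theorem exists_smul_of_mem_Sp (hP : ∀ x y, ωF (P.p x) (P.p y) = ω x y) (hnd : ωF.Nondegenerate)
    (g : Sp ω) : ∃ c : ℂ, c ≠ 0 ∧ g.1 e₀ = c • e₀ := by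
  have h : P.p (g.1 e₀) = 0 := by
    refine hnd.1 _ fun w => ?_
    obtain ⟨x, rfl⟩ := P.p_surjective w
    obtain ⟨y, rfl⟩ := g.1.surjective x
    rw [hP, g.2, ← hP, P.p_self, map_zero, LinearMap.zero_apply]
  refine ⟨_, fun h0 => ?_, P.eq_smul_of_p_eq_zero h⟩
  have h1 := P.eq_smul_of_p_eq_zero h
  rw [h0, zero_smul] at h1
  exact P.ne_zero ((LinearEquiv.map_eq_zero_iff g.1).1 h1)

theorem mem_move_iff (hP : ∀ x y, ωF (P.p x) (P.p y) = ω x y) (hnd : ωF.Nondegenerate)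
    (g : Sp ω) (V : Submodule ℂ E) : e₀ ∈ move g.1 V ↔ e₀ ∈ V := by
  have key : ∀ (g : Sp ω) (V : Submodule ℂ E), e₀ ∈ V → e₀ ∈ move g.1 V := by
    intro g V hV
    obtain ⟨c, hc, hg⟩ := exists_smul_of_mem_Sp hP hnd g
    exact (Submodule.smul_mem_iff _ hc).1 (hg ▸ ⟨e₀, hV, rfl⟩)
  refine ⟨fun h => ?_, key g V⟩
  have h1 := key g⁻¹ _ h
  have h2 : move (g⁻¹ : Sp ω).1 (move g.1 V) = V := by
    rw [← move_mul]
    change move (g⁻¹ * g : Sp ω).1 V = V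
    rw [inv_mul_cancel]
    exact move_one V
  rwa [h2] at h1

theorem eq_of_mem_flagStratum {V : IsoFlag ω (n + 1)} {i j : Fin (n + 1)}
    (hi : V ∈ flagStratum ω e₀ n i) (hj : V ∈ flagStratum ω e₀ n j) : i = j := by
  by_contra h
  rcases lt_or_gt_of_ne h with h | h
  · exact hj.2 (V.1.mono (show i.succ ≤ j.castSucc from h) hi.1)
  · exact hi.2 (V.1.mono (show j.succ ≤ i.castSucc from h) hj.1)

theorem isIsotropic_grGraph_iff (hP : ∀ x y, ωF (P.p x) (P.p y) = ω x y) {x : Gr.DualTaut F k} :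
    IsIsotropic ω (P.grGraph x).1 ↔ IsIsotropic ωF x.1.1 :=
  ⟨fun h => isIsotropic_of_exists hP h fun w hw => ⟨_, ⟨⟨w, hw⟩, rfl⟩, P.p_add_smul _ _⟩,
    fun h => isIsotropic_of_p_mem hP h fun _ hx => (P.mem_graph.1 hx).1⟩

/-! ### Topology of the strata -/

theorem isOpen_notMem [FiniteDimensional ℂ E] (P : Splitting e₀ F) :
    IsOpen[(Gr.space E k).top] {V : Gr E k | e₀ ∉ V.1} := by
  refine (@isOpen_iff_forall_mem_open _ (Gr.space E k).top _).2 fun V hV => ?_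
  obtain ⟨b, hb⟩ := P.exists_isChart_comp_p hV
  exact ⟨_, fun V' hV' => P.notMem_of_isChart hV', Gr.isOpen_isChart (fun t => b t ∘ₗ P.p), hb⟩

theorem isOpen_grAvoiding [FiniteDimensional ℂ E] (P : Splitting e₀ F) (ω : LinearMap.BilinForm ℂ E) :
    IsOpen[(IsoGr.space ω k).top] (grAvoiding ω e₀ k) :=
  ⟨_, P.isOpen_notMem, rfl⟩

theorem isClosed_grContaining [FiniteDimensional ℂ E] (P : Splitting e₀ F) (ω : LinearMap.BilinForm ℂ E) :
    IsClosed[(IsoGr.space ω k).top] (grContaining ω e₀ k) :=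
  (@isOpen_compl_iff _ _ (IsoGr.space ω k).top).1 (P.isOpen_grAvoiding ω)

variable [FiniteDimensional ℂ F]

theorem isIsotropic_grComap_iff (hP : ∀ x y, ωF (P.p x) (P.p y) = ω x y) {W : Gr F k} :
    IsIsotropic ω (P.grComap W).1 ↔ IsIsotropic ωF W.1 :=
  ⟨fun h => isIsotropic_of_exists hP h fun w hw => ⟨P.sec w, by
    rw [grComap, Submodule.mem_comap, P.p_sec]
    exact hw, P.p_sec w⟩, fun h => isIsotropic_of_p_mem hP h fun _ hx => hx⟩

theorem isIsotropic_flagGraph_iff (hP : ∀ x y, ωF (P.p x) (P.p y) = ω x y) {i : Fin (n + 1)}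
    {x : Flag.DualTaut F n i} :
    (∀ j, IsIsotropic ω ((P.flagGraph i x).V j)) ↔ ∀ j, IsIsotropic ωF (x.1.V j) :=
  -- The largest member is a full preimage and so contains `sec` of every member of the flag in `F`.
  ⟨fun h _ => isIsotropic_of_exists hP (h (Fin.last _)) fun w hw =>
      ⟨P.sec w, P.sec_mem_flagGraph_last i x hw, P.p_sec w⟩,
    fun h _ => isIsotropic_of_p_mem hP (h _) fun _ hx => P.p_mem_of_mem_flagGraph hx⟩

theorem self_mem_grComap (W : Gr F k) : e₀ ∈ (P.grComap W).1 := by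
  rw [grComap, Submodule.mem_comap, P.p_self]
  exact zero_mem _

/-! ### The strata are nonempty -/

theorem exists_isotropic_frame (hωF : ωF.IsAlt) (hnd : ωF.Nondegenerate)
    (hF : Module.finrank ℂ F = 2 * n) (hk : k ≤ n) : ∃ u : Frame F k, IsotropicFamily ωF u.1 := by
  obtain ⟨u, hu, huω, -⟩ := IsotropicFamily.exists_extend hωF hnd hF
    (u := (Fin.elim0 : Fin 0 → F)) linearIndependent_empty_type (fun s => s.elim0) k.zero_le hk
  exact ⟨⟨u, hu⟩, huω⟩

theorem grAvoiding_nonempty (hP : ∀ x y, ωF (P.p x) (P.p y) = ω x y) (hωF : ωF.IsAlt)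
    (hnd : ωF.Nondegenerate) (hF : Module.finrank ℂ F = 2 * n) (hk : k ≤ n) :
    (grAvoiding ω e₀ k).Nonempty := by
  obtain ⟨u, hu⟩ := exists_isotropic_frame hωF hnd hF hk
  exact ⟨⟨P.grGraph ⟨Gr.ofFrame u, 0⟩, (isIsotropic_grGraph_iff hP).2 hu.isIsotropic_span⟩,
    P.notMem_graph _ _⟩

theorem grContaining_nonempty (hP : ∀ x y, ωF (P.p x) (P.p y) = ω x y) (hωF : ωF.IsAlt)
    (hnd : ωF.Nondegenerate) (hF : Module.finrank ℂ F = 2 * n) (hk : k + 1 ≤ n) :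
    (grContaining ω e₀ (k + 1)).Nonempty := by
  obtain ⟨u, hu⟩ := exists_isotropic_frame hωF hnd hF (Nat.le_of_succ_le hk)
  exact ⟨⟨P.grComap (Gr.ofFrame u), (isIsotropic_grComap_iff hP).2 hu.isIsotropic_span⟩,
    P.self_mem_grComap (Gr.ofFrame u)⟩

theorem flagStratum_nonempty (hP : ∀ x y, ωF (P.p x) (P.p y) = ω x y) (hωF : ωF.IsAlt)
    (hnd : ωF.Nondegenerate) (hF : Module.finrank ℂ F = 2 * n) (i : Fin (n + 1)) :
    (flagStratum ω e₀ n i).Nonempty := by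
  obtain ⟨u, hu⟩ := exists_isotropic_frame hωF hnd hF le_rfl
  refine ⟨⟨P.flagGraph i ⟨Flag.ofFrame u, 0⟩, (isIsotropic_flagGraph_iff hP).2 fun j => ?_⟩,
    P.self_mem_flagGraph _ _, P.self_notMem_flagGraph _ _⟩
  exact IsotropicFamily.isIsotropic_span (u := initialFamily u.1 j) fun s t => hu _ _

variable [FiniteDimensional ℂ E]

/-! ### Isomorphisms of the strata with total spaces of bundles -/

theorem isomorphic_flagStratum (hP : ∀ x y, ωF (P.p x) (P.p y) = ω x y) (i : Fin (n + 1)) :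
    ((IsoFlag.space ω (n + 1)).sub (flagStratum ω e₀ n i)).Isomorphic
      (IsoFlag.dualTautSpace ωF n i) := by
  refine FunSpace.isomorphic_of_local (Ψ := P.flagGraph i)
    (Subtype.val_injective.comp Subtype.val_injective) ?_ (P.isMorphism_flagGraph i)
    (P.flagGraph_injective i) (fun y => ⟨?_, ?_⟩) fun z => ?_
  · rintro ⟨⟨W, hW⟩, φ⟩ ⟨⟨W', hW'⟩, φ'⟩ h
    obtain ⟨rfl, h⟩ := Sigma.mk.inj_iff.1 h
    obtain rfl := eq_of_heq h
    rfl
  · rintro ⟨z, hz⟩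
    exact ⟨⟨⟨y.1, (isIsotropic_flagGraph_iff hP).1 (hz ▸ z.1.2)⟩, y.2⟩, rfl⟩
  · rintro ⟨y, rfl⟩
    exact ⟨⟨⟨P.flagGraph i ⟨y.1.1, y.2⟩, (isIsotropic_flagGraph_iff hP).2 y.1.2⟩,
      P.self_mem_flagGraph _ _, P.self_notMem_flagGraph _ _⟩, rfl⟩
  · obtain ⟨U, hU, ρ, hρ, h⟩ := P.flagGraph_local i z.1.1 z.2.1 z.2.2
    exact ⟨U, hU, ρ, hρ, fun z' hz' => h _ hz' z'.2.1⟩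

theorem isomorphic_grAvoiding (hP : ∀ x y, ωF (P.p x) (P.p y) = ω x y) :
    ((IsoGr.space ω k).sub (grAvoiding ω e₀ k)).Isomorphic (IsoGr.dualTautSpace ωF k) := by
  refine FunSpace.isomorphic_of_local (Ψ := P.grGraph)
    (Subtype.val_injective.comp Subtype.val_injective) ?_ P.isMorphism_grGraph
    P.grGraph_injective (fun y => ⟨?_, ?_⟩) fun z => ?_
  · rintro ⟨⟨W, hW⟩, φ⟩ ⟨⟨W', hW'⟩, φ'⟩ h
    obtain ⟨rfl, h⟩ := Sigma.mk.inj_iff.1 h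
    obtain rfl := eq_of_heq h
    rfl
  · rintro ⟨z, hz⟩
    exact ⟨⟨⟨y.1, (isIsotropic_grGraph_iff hP).1 (hz ▸ z.1.2)⟩, y.2⟩, rfl⟩
  · rintro ⟨y, rfl⟩
    exact ⟨⟨⟨P.grGraph ⟨y.1.1, y.2⟩, (isIsotropic_grGraph_iff hP).2 y.1.2⟩,
      P.notMem_graph _ _⟩, rfl⟩
  · obtain ⟨U, hU, ρ, hρ, h⟩ := P.grGraph_local z.1.1 z.2
    exact ⟨U, hU, ρ, hρ, fun z' hz' => h _ hz'⟩

theorem isomorphic_grContaining (hP : ∀ x y, ωF (P.p x) (P.p y) = ω x y) :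
    ((IsoGr.space ω (k + 1)).sub (grContaining ω e₀ (k + 1))).Isomorphic (IsoGr.space ωF k) := by
  refine FunSpace.isomorphic_of_local (Ψ := P.grComap)
    (Subtype.val_injective.comp Subtype.val_injective) Subtype.val_injective P.isMorphism_grComap
    P.grComap_injective (fun y => ⟨?_, ?_⟩) fun z => ?_
  · rintro ⟨z, hz⟩
    exact ⟨⟨y, (isIsotropic_grComap_iff hP).1 (hz ▸ z.1.2)⟩, rfl⟩
  · rintro ⟨y, rfl⟩
    exact ⟨⟨⟨P.grComap y.1, (isIsotropic_grComap_iff hP).2 y.2⟩, P.self_mem_grComap _⟩, rfl⟩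
  · obtain ⟨U, hU, ρ, hρ, h⟩ := P.grComap_local z.1.1 z.2
    exact ⟨U, hU, ρ, hρ, fun z' hz' => h _ hz' z'.2⟩

/-! ### Transitivity -/

/-- Witt's theorem for families that are independent modulo the kernel. -/
theorem exists_mem_Sp (hP : ∀ x y, ωF (P.p x) (P.p y) = ω x y) (hωF : ωF.IsAlt)
    (hnd : ωF.Nondegenerate) (hF : Module.finrank ℂ F = 2 * n) {v v' : Fin k → E}
    (hv : LinearIndependent ℂ fun s => P.p (v s)) (hvω : IsotropicFamily ω v)
    (hv' : LinearIndependent ℂ fun s => P.p (v' s)) (hvω' : IsotropicFamily ω v') :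
    ∃ g : Sp ω, g.1 e₀ = e₀ ∧ ∀ s, g.1 (v s) = v' s := by
  obtain ⟨h, hh, hhv⟩ := IsotropicFamily.exists_isometry hωF hnd hF hωF hnd hF hv
    (fun s t => (hP _ _).trans (hvω s t)) hv' (fun s t => (hP _ _).trans (hvω' s t))
  -- The isometry `h` matches the images in `F`; `ψ` supplies the missing difference along `e₀`. It
  -- enters only through `ψ ∘ p`, so `e₀` stays fixed and `ω` is unaffected.
  obtain ⟨ψ, hψ⟩ := exists_dual_apply_eq hv fun s => P.lam (v' s) - P.lam (v s)
  let f : E →ₗ[ℂ] E := P.sec ∘ₗ h.toLinearMap ∘ₗ P.p + (P.lam + ψ ∘ₗ P.p).smulRight e₀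
  have hf : ∀ x, f x = P.sec (h (P.p x)) + (P.lam x + ψ (P.p x)) • e₀ := fun x => rfl
  have hpf : ∀ x, P.p (f x) = h (P.p x) := fun x => by rw [hf, P.p_add_smul]
  have hinj : Function.Injective f := by
    refine (injective_iff_map_eq_zero f).2 fun x hx => ?_
    have h1 : P.p x = 0 := by
      have := hpf x
      rw [hx, map_zero] at this
      exact (LinearEquiv.map_eq_zero_iff h).1 this.symm
    have h2 : P.lam x = 0 := by
      have := congrArg P.lam hx
      rwa [hf, P.lam_add_smul, h1, map_zero, map_zero, add_zero] at this
    rw [← P.decomp x, h1, h2, map_zero, zero_smul, add_zero]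
  refine ⟨⟨LinearEquiv.ofInjectiveEndo f hinj, fun x y => ?_⟩, ?_, fun s => ?_⟩
  · change ω (f x) (f y) = _
    rw [← hP, hpf, hpf, hh, hP]
  · change f e₀ = e₀
    rw [hf, P.p_self, P.lam_self, map_zero, map_zero, map_zero, zero_add, add_zero, one_smul]
  · change f (v s) = v' s
    rw [hf, hhv, hψ, add_sub_cancel, P.decomp]

/-! ### Orbits in the odd symplectic Grassmannian -/

theorem exists_smul_eq_of_grAvoiding (hP : ∀ x y, ωF (P.p x) (P.p y) = ω x y) (hωF : ωF.IsAlt)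
    (hnd : ωF.Nondegenerate) (hF : Module.finrank ℂ F = 2 * n) {V V' : IsoGr ω k}
    (hV : V ∈ grAvoiding ω e₀ k) (hV' : V' ∈ grAvoiding ω e₀ k) : ∃ g : Sp ω, g • V = V' := by
  obtain ⟨V, hVω⟩ := V
  obtain ⟨V', hVω'⟩ := V'
  replace hV : e₀ ∉ V.1 := hV
  replace hV' : e₀ ∉ V'.1 := hV'
  obtain ⟨v, rfl⟩ := Gr.exists_frame V
  obtain ⟨v', rfl⟩ := Gr.exists_frame V'
  obtain ⟨g, -, hg⟩ := exists_mem_Sp hP hωF hnd hF (P.linearIndependent_p v.2 hV)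
    (fun s t => hVω _ (Gr.mem_ofFrame v s) _ (Gr.mem_ofFrame v t))
    (P.linearIndependent_p v'.2 hV')
    (fun s t => hVω' _ (Gr.mem_ofFrame v' s) _ (Gr.mem_ofFrame v' t))
  refine ⟨g, Subtype.ext (Gr.ofFrame_eq fun s => ?_).symm⟩
  exact Submodule.mem_map.2 ⟨v.1 s, Gr.mem_ofFrame v s, hg s⟩

theorem exists_smul_eq_of_grContaining (hP : ∀ x y, ωF (P.p x) (P.p y) = ω x y) (hωF : ωF.IsAlt)
    (hnd : ωF.Nondegenerate) (hF : Module.finrank ℂ F = 2 * n) {V V' : IsoGr ω (k + 1)}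
    (hV : V ∈ grContaining ω e₀ (k + 1)) (hV' : V' ∈ grContaining ω e₀ (k + 1)) :
    ∃ g : Sp ω, g • V = V' := by
  obtain ⟨V, hVω⟩ := V
  obtain ⟨V', hVω'⟩ := V'
  replace hV : e₀ ∈ V.1 := hV
  replace hV' : e₀ ∈ V'.1 := hV'
  obtain ⟨W, rfl⟩ := P.exists_grComap_eq hV
  obtain ⟨W', rfl⟩ := P.exists_grComap_eq hV'
  obtain ⟨u, rfl⟩ := Gr.exists_frame W
  obtain ⟨u', rfl⟩ := Gr.exists_frame W'
  rw [isIsotropic_grComap_iff hP] at hVω hVω'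
  have h : ∀ u : Frame F k, IsIsotropic ωF (Gr.ofFrame u).1 →
      IsotropicFamily ω fun s => P.sec (u.1 s) := fun u hu s t => by
    rw [← hP, P.p_sec, P.p_sec]
    exact hu _ (Gr.mem_ofFrame u s) _ (Gr.mem_ofFrame u t)
  have h' : ∀ u : Frame F k, LinearIndependent ℂ fun s => P.p (P.sec (u.1 s)) := fun u => by
    simpa only [P.p_sec] using u.2
  obtain ⟨g, hg0, hg⟩ := exists_mem_Sp hP hωF hnd hF (h' u) (h u hVω) (h' u') (h u' hVω')
  refine ⟨g, Subtype.ext ?_⟩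
  refine Eq.trans (Gr.ofFrame_eq fun s => ?_).symm (P.grComap_ofFrame u').symm
  refine Fin.cases ?_ (fun s => ?_) s
  · exact ⟨e₀, P.self_mem_grComap _, hg0⟩
  · refine ⟨P.sec (u.1 s), ?_, hg s⟩
    change P.p (P.sec (u.1 s)) ∈ (Gr.ofFrame u).1
    rw [P.p_sec]
    exact Gr.mem_ofFrame u s

theorem orbits_isoGr (hP : ∀ x y, ωF (P.p x) (P.p y) = ω x y) (hωF : ωF.IsAlt)
    (hnd : ωF.Nondegenerate) (hF : Module.finrank ℂ F = 2 * n) (hk : k + 1 ≤ n) :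
    orbits (Sp ω) (IsoGr ω (k + 1)) = {grContaining ω e₀ (k + 1), grAvoiding ω e₀ (k + 1)} := by
  refine orbits_eq_of_transitive ?_ (fun V => ?_) ?_ ?_
  · rintro s (rfl | rfl)
    · exact grContaining_nonempty hP hωF hnd hF hk
    · exact grAvoiding_nonempty hP hωF hnd hF hk
  · by_cases h : e₀ ∈ V.1.1
    · exact ⟨_, Or.inl rfl, h⟩
    · exact ⟨_, Or.inr rfl, h⟩
  · rintro s (rfl | rfl) V hV g
    · exact (mem_move_iff hP hnd g _).2 hV
    · exact fun h => hV ((mem_move_iff hP hnd g _).1 h)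
  · rintro s (rfl | rfl) V hV V' hV'
    · exact exists_smul_eq_of_grContaining hP hωF hnd hF hV hV'
    · exact exists_smul_eq_of_grAvoiding hP hωF hnd hF hV hV'

/-! ### Orbits in the odd symplectic flag manifold -/

/-- Otherwise `p` would be injective on this member and its image would be isotropic of dimension `n
+ 1`, against `IsotropicFamily.card_le`. -/
theorem mem_last_of_isIsotropic (hP : ∀ x y, ωF (P.p x) (P.p y) = ω x y)
    (hnd : ωF.Nondegenerate) (hF : Module.finrank ℂ F = 2 * n) (V : IsoFlag ω (n + 1)) :
    e₀ ∈ V.1.V (Fin.last (n + 1)) := by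
  by_contra h
  obtain ⟨v, hv⟩ := Gr.exists_frame (⟨V.1.V (Fin.last (n + 1)), V.1.finrank_eq _⟩ : Gr E (n + 1))
  have hv' := congrArg Subtype.val hv
  change Submodule.span ℂ (Set.range v.1) = V.1.V (Fin.last (n + 1)) at hv'
  have hm : ∀ s, v.1 s ∈ V.1.V (Fin.last (n + 1)) := fun s => hv' ▸ Gr.mem_ofFrame v s
  have hli := P.linearIndependent_p v.2 (by rwa [hv'])
  have := IsotropicFamily.card_le (ω := ωF) hnd hF hli fun s t =>
    (hP _ _).trans (V.2 _ _ (hm s) _ (hm t))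
  omega

/-- If `e₀` never entered, its membership in the last member would descend to the zero subspace. -/
theorem exists_mem_flagStratum (hP : ∀ x y, ωF (P.p x) (P.p y) = ω x y)
    (hnd : ωF.Nondegenerate) (hF : Module.finrank ℂ F = 2 * n) (V : IsoFlag ω (n + 1)) :
    ∃ i, V ∈ flagStratum ω e₀ n i := by
  by_contra! h
  have h1 : ∀ j, e₀ ∈ V.1.V j := fun j => by
    induction j using Fin.reverseInduction with
    | last => exact mem_last_of_isIsotropic hP hnd hF V
    | cast i ih => exact by_contra fun h' => h i ⟨ih, h'⟩
  have h2 : V.1.V 0 = ⊥ := Submodule.finrank_eq_zero.1 (V.1.finrank_eq 0)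
  have h3 := h1 0
  rw [h2, Submodule.mem_bot] at h3
  exact P.ne_zero h3

/-- Take adapted frames with `e₀` in place `i`. The other `n` vectors are independent modulo `e₀`,
so an isometry fixing `e₀` carries one frame to the other. -/
theorem exists_smul_eq_of_flagStratum (hP : ∀ x y, ωF (P.p x) (P.p y) = ω x y) (hωF : ωF.IsAlt)
    (hnd : ωF.Nondegenerate) (hF : Module.finrank ℂ F = 2 * n) {i : Fin (n + 1)}
    {V V' : IsoFlag ω (n + 1)} (hV : V ∈ flagStratum ω e₀ n i) (hV' : V' ∈ flagStratum ω e₀ n i) :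
    ∃ g : Sp ω, g • V = V' := by
  have hmem : ∀ {V : IsoFlag ω (n + 1)} {v : Frame E (n + 1)}, Flag.ofFrame v = V.1 →
      ∀ s : Fin (n + 1), v.1 s ∈ V.1.V s.succ := fun h s => h ▸ Flag.mem_ofFrame _ (by simp)
  have hiso : ∀ {V : IsoFlag ω (n + 1)} {v : Frame E (n + 1)}, Flag.ofFrame v = V.1 →
      IsotropicFamily ω fun t => v.1 (i.succAbove t) := fun {V v} h s t =>
    V.2 (Fin.last _) _ (V.1.mono (Fin.le_last _) (hmem h _)) _
      (V.1.mono (Fin.le_last _) (hmem h _))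
  have hli : ∀ {v : Frame E (n + 1)}, v.1 i = e₀ →
      LinearIndependent ℂ fun t => P.p (v.1 (i.succAbove t)) := fun {v} h => by
    refine P.linearIndependent_p (u := fun t => v.1 (i.succAbove t))
      (v.2.comp _ Fin.succAbove_right_injective) ?_
    rw [← Function.comp_def, Set.range_comp, ← h]
    exact v.2.notMem_span_image (by simp)
  obtain ⟨v, hv, hvV⟩ := V.1.exists_frame_apply_eq i e₀ hV.1 hV.2
  obtain ⟨v', hv', hvV'⟩ := V'.1.exists_frame_apply_eq i e₀ hV'.1 hV'.2
  obtain ⟨g, hg0, hg⟩ := exists_mem_Sp hP hωF hnd hF (hli hv) (hiso hvV) (hli hv') (hiso hvV')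
  have hg' : ∀ s, g.1 (v.1 s) = v'.1 s := fun s => by
    rcases Fin.eq_self_or_eq_succAbove i s with rfl | ⟨t, rfl⟩
    · rw [hv, hv', hg0]
    · exact hg t
  refine ⟨g, Subtype.ext ?_⟩
  rw [← hvV']
  refine (Flag.ofFrame_eq fun s => ?_).symm
  exact Submodule.mem_map.2 ⟨v.1 s, hmem hvV s, hg' s⟩

theorem orbits_isoFlag (hP : ∀ x y, ωF (P.p x) (P.p y) = ω x y) (hωF : ωF.IsAlt)
    (hnd : ωF.Nondegenerate) (hF : Module.finrank ℂ F = 2 * n) :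
    orbits (Sp ω) (IsoFlag ω (n + 1)) = Set.range (flagStratum ω e₀ n) := by
  refine orbits_eq_of_transitive ?_ (fun V => ?_) ?_ ?_
  · rintro _ ⟨i, rfl⟩
    exact flagStratum_nonempty hP hωF hnd hF i
  · obtain ⟨i, hi⟩ := exists_mem_flagStratum hP hnd hF V
    exact ⟨_, ⟨i, rfl⟩, hi⟩
  · rintro _ ⟨i, rfl⟩ V hV g
    exact ⟨(mem_move_iff hP hnd g _).2 hV.1, fun h => hV.2 ((mem_move_iff hP hnd g _).1 h)⟩
  · rintro _ ⟨i, rfl⟩ V hV V' hV'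
    exact exists_smul_eq_of_flagStratum hP hωF hnd hF hV hV'

end Splitting

end

end OddSymplectic

/-! ### Assembly of the theorem. -/

theorem mainTheorem7 (n : ℕ)
    {E : Type*} [AddCommGroup E] [Module ℂ E] (hE : Module.finrank ℂ E = 2 * n + 1)
    (ω : LinearMap.BilinForm ℂ E) (hω : ω.IsAlt)
    (hrank : Module.finrank ℂ (LinearMap.range ω) = 2 * n)
    (e₀ : E) (he₀ : LinearMap.ker ω = Submodule.span ℂ {e₀})
    {F : Type*} [AddCommGroup F] [Module ℂ F] [FiniteDimensional ℂ F]
    (hF : Module.finrank ℂ F = 2 * n)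
    (ωF : LinearMap.BilinForm ℂ F) (hωF : ωF.IsAlt) (hnd : ωF.Nondegenerate) :
    -- the orbits in the odd symplectic flag manifold
    (orbits (Sp ω) (IsoFlag ω (n + 1)) = Set.range (flagStratum ω e₀ n) ∧
      Function.Injective (flagStratum ω e₀ n) ∧
      ∀ i : Fin (n + 1),
        ((IsoFlag.space ω (n + 1)).sub (flagStratum ω e₀ n i)).Isomorphic
          (IsoFlag.dualTautSpace ωF n i)) ∧
    -- the orbits in the odd symplectic Grassmannians
    ∀ k : ℕ, 1 ≤ k → k ≤ n →
      orbits (Sp ω) (IsoGr ω k) = {grContaining ω e₀ k, grAvoiding ω e₀ k} ∧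
      grContaining ω e₀ k ≠ grAvoiding ω e₀ k ∧
      IsClosed[(IsoGr.space ω k).top] (grContaining ω e₀ k) ∧
      IsOpen[(IsoGr.space ω k).top] (grAvoiding ω e₀ k) ∧
      ((IsoGr.space ω k).sub (grContaining ω e₀ k)).Isomorphic (IsoGr.space ωF (k - 1)) ∧
      ((IsoGr.space ω k).sub (grAvoiding ω e₀ k)).Isomorphic (IsoGr.dualTautSpace ωF k) := by
  have : FiniteDimensional ℂ E := Module.finite_of_finrank_pos (by omega)
  obtain ⟨P, hP⟩ := exists_splitting hE ω hω hrank e₀ he₀ hF ωF hωF hnd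
  refine ⟨⟨Splitting.orbits_isoFlag hP hωF hnd hF, fun i j hij => ?_,
    Splitting.isomorphic_flagStratum hP⟩, fun k hk hkn => ?_⟩
  -- The strata are nonempty and pairwise disjoint, hence distinct: there are exactly `n + 1`
  -- orbits.
  · obtain ⟨V, hV⟩ := Splitting.flagStratum_nonempty hP hωF hnd hF i
    exact Splitting.eq_of_mem_flagStratum hV (hij ▸ hV)
  · obtain ⟨k, rfl⟩ := Nat.exists_eq_succ_of_ne_zero (Nat.one_le_iff_ne_zero.1 hk)
    refine ⟨Splitting.orbits_isoGr hP hωF hnd hF hkn, fun h => ?_, P.isClosed_grContaining ω,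
      P.isOpen_grAvoiding ω, Splitting.isomorphic_grContaining hP,
      Splitting.isomorphic_grAvoiding hP⟩
    obtain ⟨V, hV⟩ := Splitting.grContaining_nonempty hP hωF hnd hF hkn
    have hV' : V ∈ grAvoiding ω e₀ (k + 1) := h ▸ hV
    exact hV' hV
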